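/- All rings are unital (not necessarily commutative) and all modules are right modules. A $\mathbb Z$-graded ring is a ring $R[t,t^{-1}]$ with a direct sum decomposition $R[t,t^{-1}]=\bigoplus_{k\in\mathbb Z}R_k$ into additive subgroups such that $R_kR_\ell\subseteq R_{k+\ell}$ for all $k,\ell\in\mathbb Z$, where $R_kR_\ell$ is the set of finite sums of products $xy$ with $x\in R_k$, $y\in R_\ell$; the notation $R[t,t^{-1}]$ is purely suggestive, and no element $t$ is assumed to exist. The ring is called strongly $\mathbb Z$-graded if $R_kR_\ell=R_{k+\ell}$ for all $k,\ell\in\mathbb Z$. The component $R_0$ is a subring. The Novikov rings are $$R((t))=\bigoplus_{n<0}R_n\oplus\prod_{n\ge 0}R_n,\qquad R((t^{-1}))=\prod_{n\le 0}R_n\oplus\bigoplus_{n>0}R_n,$$ that is, the rings of formal series $\sum_{n\in\mathbb Z}a_nt^n$ with $a_n\in R_n$ for all $n$ and with $a_n=0$ for $n\ll 0$, respectively for $n\gg 0$, under the product $\left(\sum_i a_it^i\right)\left(\sum_j b_jt^j\right)=\sum_n\left(\sum_{i+j=n}a_ib_j\right)t^n$. Both contain $R[t,t^{-1}]$ as a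 subring. A bounded chain complex of $R[t,t^{-1}]$-modules is called $R_0$-finitely dominated if, considered as a complex of $R_0$-modules, it is a retract up to chain homotopy of a bounded complex of finitely generated free $R_0$-modules. Theorem 1.2. Let $R[t,t^{-1}]=\bigoplus_{k\in\mathbb Z}R_k$ be a strongly $\mathbb Z$-graded ring, and let $C$ be a bounded chain complex of finitely generated free $R[t,t^{-1}]$-modules. Then $C$ is $R_0$-finitely dominated if and only if both complexes $$C\otimes_{R[t,t^{-1}]}R((t^{-1}))\qquad\text{and}\qquad C\otimes_{R[t,t^{-1}]}R((t))$$ have vanishing homology in all degrees. Likewise, $C$ is homotopy equivalent, as a complex of $R_0$-modules, to a bounded complex of finitely generated projective $R_0$-modules if and only if both of these complexes have vanishing homology in all degrees. -/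

import Mathlib

open CategoryTheory
open scoped TensorProduct

universe u

/-! ### Strongly graded rings

A ring `L` graded by additive subgroups `𝒜 k`, `k ∈ ℤ`, is given by Mathlib's `GradedRing 𝒜`.
The ring `L` plays the role of `R[t, t⁻¹]`, the subgroup `𝒜 k` that of `R_k`. -/

/-- A `ℤ`-graded ring is strongly graded if `L_k L_l = L_{k+l}` for all `k, l`, where `L_k L_l`
consists of the finite sums of products `x * y` with `x ∈ L_k` and `y ∈ L_l`. -/
def IsStronglyGraded {L : Type u} [Ring L] (𝒜 : ℤ → AddSubgroup L) : Prop :=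
  ∀ k l : ℤ,
    AddSubgroup.closure {z : L | ∃ x ∈ 𝒜 k, ∃ y ∈ 𝒜 l, z = x * y} = 𝒜 (k + l)

/-- The opposite grading: the component of degree `k` is the old component of degree `-k`. -/
def negGrading {L : Type u} [Ring L] (𝒜 : ℤ → AddSubgroup L) : ℤ → AddSubgroup L :=
  fun k => 𝒜 (-k)

/-- The map `L_i → (negGrading)_{-i}`, the identity on elements. -/
def negGradingCast {L : Type u} [Ring L] (𝒜 : ℤ → AddSubgroup L) (i : ℤ) :
    𝒜 i →+ negGrading 𝒜 (-i) where
  toFun x := ⟨x, by simp [negGrading]⟩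
  map_zero' := rfl
  map_add' _ _ := rfl

/-- The opposite grading makes the same ring a graded ring. -/
noncomputable instance negGrading.gradedRing {L : Type u} [Ring L] (𝒜 : ℤ → AddSubgroup L)
    [GradedRing 𝒜] : GradedRing (negGrading 𝒜) where
  one_mem := by
    change (1 : L) ∈ 𝒜 (-0)
    simpa using SetLike.GradedOne.one_mem (A := 𝒜)
  mul_mem := by
    intro i j x y hx hy
    change x * y ∈ 𝒜 (-(i + j))
    rw [neg_add]
    exact SetLike.GradedMul.mul_mem hx hy
  toDecomposition := DirectSum.Decomposition.ofAddHom (negGrading 𝒜)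
    ((DirectSum.toAddMonoid fun i : ℤ =>
      (DirectSum.of (fun k => negGrading 𝒜 k) (-i)).comp (negGradingCast 𝒜 i)).comp
        (DirectSum.decomposeAddEquiv 𝒜).toAddMonoidHom)
    (by
      ext x
      induction x using DirectSum.Decomposition.inductionOn 𝒜 with
      | zero => simp
      | homogeneous x => simp [negGradingCast]
      | add x y hx hy => rw [map_add, map_add, hx, hy])
    (by
      ext i x : 2
      have hx : (x : L) ∈ 𝒜 (-i) := x.2
      have key : ∀ (j k : ℤ) (h : -j = k) (x : L) (hj : x ∈ negGrading 𝒜 (-j))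
          (hk : x ∈ negGrading 𝒜 k),
          DirectSum.of (fun k => negGrading 𝒜 k) (-j) ⟨x, hj⟩ =
            DirectSum.of (fun k => negGrading 𝒜 k) k ⟨x, hk⟩ := by
        rintro j _ rfl x _ _; rfl
      simp only [AddMonoidHom.comp_apply, DirectSum.coeAddMonoidHom_of, AddMonoidHom.id_apply]
      change (DirectSum.toAddMonoid _) (DirectSum.decompose 𝒜 (x : L)) = _
      rw [DirectSum.decompose_of_mem 𝒜 hx, DirectSum.toAddMonoid_of]
      exact key (-i) i (neg_neg i) x _ _)

/-! ### Novikov rings -/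

/-- The Novikov ring `R((t))` of the graded ring `L = ⨁ R_k`, that is
`⨁_{n < 0} R_n ⊕ ∏_{n ≥ 0} R_n`: the ring of formal series `∑ a_n t^n` with
`a_n ∈ R_n` for all `n`, and `a_n = 0` for `n ≪ 0`; multiplication is the Cauchy product.
It is realised inside the ring `HahnSeries ℤ L` of formal Laurent series over `L`. -/
def Novikov {L : Type u} [Ring L] (𝒜 : ℤ → AddSubgroup L) [GradedRing 𝒜] :
    Subring (HahnSeries ℤ L) where
  carrier := {x | ∀ n : ℤ, x.coeff n ∈ 𝒜 n}
  zero_mem' n := (𝒜 n).zero_mem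
  add_mem' hx hy n := (𝒜 n).add_mem (hx n) (hy n)
  neg_mem' hx n := (𝒜 n).neg_mem (hx n)
  one_mem' n := by
    rw [HahnSeries.coeff_one]
    split_ifs with h
    · subst h; exact SetLike.GradedOne.one_mem
    · exact (𝒜 n).zero_mem
  mul_mem' {x y} hx hy n := by
    rw [HahnSeries.coeff_mul]
    refine (𝒜 n).sum_mem fun ij hij => ?_
    rw [← (Finset.mem_antidiagonal.mp hij).2.2]
    exact SetLike.GradedMul.mul_mem (hx _) (hy _)

theorem Novikov.mem_iff {L : Type u} [Ring L] (𝒜 : ℤ → AddSubgroup L) [GradedRing 𝒜]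
    (x : HahnSeries ℤ L) : x ∈ Novikov 𝒜 ↔ ∀ n : ℤ, x.coeff n ∈ 𝒜 n := Iff.rfl

/-- The elements of `R((t))` are exactly the families `(a_n)`, `a_n ∈ R_n`, with `a_n = 0` for
`n ≪ 0`. -/
theorem Novikov.exists_iff {L : Type u} [Ring L] (𝒜 : ℤ → AddSubgroup L) [GradedRing 𝒜]
    (a : ℤ → L) :
    (∃ x : Novikov 𝒜, x.1.coeff = a) ↔
      (∀ n, a n ∈ 𝒜 n) ∧ ∃ N : ℤ, ∀ n < N, a n = 0 := by
  constructor
  · rintro ⟨x, rfl⟩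
    refine ⟨x.2, x.1.order, fun n hn => HahnSeries.coeff_eq_zero_of_lt_order hn⟩
  · rintro ⟨h, N, hN⟩
    have hb : BddBelow (Function.support a) := by
      refine ⟨N, fun n hn => ?_⟩
      by_contra hlt
      exact hn (hN n (not_le.mp hlt))
    exact ⟨⟨⟨a, hb.isWF.isPWO⟩, h⟩, rfl⟩

/-- The inclusion `R[t, t⁻¹] → R((t))`, sending an element of the graded ring `L` to the series
of its homogeneous components. -/
noncomputable def Novikov.incl {L : Type u} [Ring L] (𝒜 : ℤ → AddSubgroup L) [GradedRing 𝒜] :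
    L →+* Novikov 𝒜 :=
  let c : L →+ HahnSeries ℤ L :=
    { toFun := fun x =>
        { coeff := fun n => (DirectSum.decompose 𝒜 x n : L)
          isPWO_support' := by
            classical
            refine Set.Finite.isPWO (((DirectSum.decompose 𝒜 x).support.finite_toSet).subset ?_)
            intro n hn
            simpa [DFinsupp.mem_support_iff] using hn }
      map_zero' := by ext n; simp
      map_add' := fun x y => by ext n; simp }
  have hc : ∀ {i : ℤ} {x : L}, x ∈ 𝒜 i → c x = HahnSeries.single i x := by
    intro i x hx
    ext n
    change (DirectSum.decompose 𝒜 x n : L) = _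
    by_cases h : n = i
    · subst h
      rw [DirectSum.decompose_of_mem_same 𝒜 hx, HahnSeries.coeff_single_same]
    · rw [DirectSum.decompose_of_mem_ne 𝒜 hx (Ne.symm h), HahnSeries.coeff_single_of_ne h]
  { toFun := fun x => ⟨c x, fun n => (DirectSum.decompose 𝒜 x n).2⟩
    map_zero' := Subtype.ext (map_zero c)
    map_add' := fun x y => Subtype.ext (map_add c x y)
    map_one' := Subtype.ext (hc SetLike.GradedOne.one_mem)
    map_mul' := fun x y => Subtype.ext (by
      change c (x * y) = c x * c y
      induction x using DirectSum.Decomposition.inductionOn 𝒜 with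
      | zero => simp
      | add x x' hx hx' => rw [add_mul, map_add, map_add, add_mul, hx, hx']
      | @homogeneous i x =>
        induction y using DirectSum.Decomposition.inductionOn 𝒜 with
        | zero => simp
        | add y y' hy hy' => rw [mul_add, map_add, map_add, mul_add, hy, hy']
        | @homogeneous j y =>
          rw [hc x.2, hc y.2, hc (SetLike.GradedMul.mul_mem x.2 y.2),
            HahnSeries.single_mul_single]) }

theorem Novikov.coeff_incl {L : Type u} [Ring L] (𝒜 : ℤ → AddSubgroup L) [GradedRing 𝒜]
    (x : L) (n : ℤ) : (Novikov.incl 𝒜 x).1.coeff n = (DirectSum.decompose 𝒜 x n : L) := rfl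

/-- The Novikov ring `R((t⁻¹)) = ∏_{n ≤ 0} R_n ⊕ ⨁_{n > 0} R_n`, written as a ring of formal
series in `s = t⁻¹`: the coefficient of `s^n = t^{-n}` lies in `R_{-n}`, and vanishes for
`n ≪ 0`. -/
noncomputable abbrev NovikovInv {L : Type u} [Ring L] (𝒜 : ℤ → AddSubgroup L) [GradedRing 𝒜] :
    Subring (HahnSeries ℤ L) :=
  Novikov (negGrading 𝒜)

/-- The inclusion `R[t, t⁻¹] → R((t⁻¹))`. -/
noncomputable abbrev NovikovInv.incl {L : Type u} [Ring L] (𝒜 : ℤ → AddSubgroup L)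
    [GradedRing 𝒜] : L →+* NovikovInv 𝒜 :=
  Novikov.incl (negGrading 𝒜)

theorem negGrading_decompose {L : Type u} [Ring L] (𝒜 : ℤ → AddSubgroup L) [GradedRing 𝒜]
    (x : L) (n : ℤ) :
    (DirectSum.decompose (negGrading 𝒜) x n : L) = (DirectSum.decompose 𝒜 x (-n) : L) := by
  induction x using DirectSum.Decomposition.inductionOn 𝒜 with
  | zero => simp
  | add x y hx hy => simp [hx, hy]
  | @homogeneous i x =>
    have hx : (x : L) ∈ negGrading 𝒜 (-i) := by simp [negGrading]
    by_cases h : n = -i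
    · subst h
      rw [DirectSum.decompose_of_mem_same _ hx, neg_neg, DirectSum.decompose_of_mem_same _ x.2]
    · rw [DirectSum.decompose_of_mem_ne _ hx (Ne.symm h),
        DirectSum.decompose_of_mem_ne _ x.2 (by omega)]

/-! ### Extension of scalars over non-commutative rings

`ModuleCat A` is the category of left `A`-modules; right modules over a ring `L` are modules over
the opposite ring `Lᵐᵒᵖ`. -/

section ExtendScalars

variable {A B : Type u} [Ring A] [Ring B] (f : A →+* B)

/-- The `B`-submodule of `B ⊗_ℤ M` generated by the elements `b f(a) ⊗ m - b ⊗ a m`. -/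
def balancedRel (M : Type u) [AddCommGroup M] [Module A M] : Submodule B (B ⊗[ℤ] M) :=
  Submodule.span B
    {z | ∃ (b : B) (a : A) (m : M), z = (b * f a) ⊗ₜ[ℤ] m - b ⊗ₜ[ℤ] (a • m)}

/-- The `B`-module `B ⊗_A M`, for a ring homomorphism `f : A → B` of not necessarily commutative
rings and a left `A`-module `M`. -/
abbrev BalancedTensor (M : Type u) [AddCommGroup M] [Module A M] : Type u :=
  (B ⊗[ℤ] M) ⧸ balancedRel f M

/-- The `B`-linear map `B ⊗_A g : B ⊗_A M → B ⊗_A N` induced by an `A`-linear map `g`. -/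
noncomputable def BalancedTensor.map {M N : Type u} [AddCommGroup M] [Module A M]
    [AddCommGroup N] [Module A N] (g : M →ₗ[A] N) :
    BalancedTensor f M →ₗ[B] BalancedTensor f N :=
  Submodule.mapQ (balancedRel f M) (balancedRel f N)
    (TensorProduct.AlgebraTensorModule.map (LinearMap.id : B →ₗ[B] B)
      (g.toAddMonoidHom.toIntLinearMap))
    (by
      rw [balancedRel, Submodule.span_le]
      rintro _ ⟨b, a, m, rfl⟩
      refine Submodule.subset_span ⟨b, a, g m, ?_⟩
      simp)

theorem BalancedTensor.map_mk_tmul {M N : Type u} [AddCommGroup M] [Module A M]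
    [AddCommGroup N] [Module A N] (g : M →ₗ[A] N) (b : B) (m : M) :
    BalancedTensor.map f g ((balancedRel f M).mkQ (b ⊗ₜ[ℤ] m)) =
      (balancedRel f N).mkQ (b ⊗ₜ[ℤ] g m) := rfl

theorem BalancedTensor.hom_ext {M N : Type u} [AddCommGroup M] [Module A M]
    [AddCommGroup N] [Module B N] {g h : BalancedTensor f M →ₗ[B] N}
    (H : ∀ (b : B) (m : M), g ((balancedRel f M).mkQ (b ⊗ₜ[ℤ] m)) =
      h ((balancedRel f M).mkQ (b ⊗ₜ[ℤ] m))) : g = h := by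
  refine Submodule.linearMap_qext _ (LinearMap.ext fun z => ?_)
  induction z using TensorProduct.induction_on with
  | zero => simp
  | tmul b m => exact H b m
  | add x y hx hy => rw [map_add, map_add, hx, hy]

/-- Extension of scalars `M ↦ B ⊗_A M` along a homomorphism of not necessarily commutative
rings. -/
noncomputable def extendScalarsNC : ModuleCat.{u} A ⥤ ModuleCat.{u} B where
  obj M := ModuleCat.of B (BalancedTensor f M)
  map g := ModuleCat.ofHom (BalancedTensor.map f g.hom)
  map_id M := by
    refine ModuleCat.hom_ext (BalancedTensor.hom_ext f fun b m => rfl)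
  map_comp g h := by
    refine ModuleCat.hom_ext (BalancedTensor.hom_ext f fun b m => rfl)

instance extendScalarsNC.additive : (extendScalarsNC f).Additive where
  map_add {M N g h} := by
    refine ModuleCat.hom_ext (BalancedTensor.hom_ext f fun b m => ?_)
    change (balancedRel f N).mkQ (b ⊗ₜ[ℤ] (g.hom m + h.hom m)) =
      (balancedRel f N).mkQ (b ⊗ₜ[ℤ] g.hom m) + (balancedRel f N).mkQ (b ⊗ₜ[ℤ] h.hom m)
    rw [TensorProduct.tmul_add, map_add]

end ExtendScalars

/-- For a ring homomorphism `φ : L → N` and a complex `C` of right `L`-modules, the complex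
`C ⊗_L N` of right `N`-modules. Since right modules are modules over opposite rings, it is
the extension of scalars along `φᵐᵒᵖ : Lᵐᵒᵖ → Nᵐᵒᵖ`; the class of `op n ⊗ m` stands for `m ⊗ n`,
subject to `m l ⊗ n = m ⊗ φ(l) n`. -/
noncomputable def tensorComplex {L N : Type u} [Ring L] [Ring N] (φ : L →+* N)
    (C : ChainComplex (ModuleCat.{u} Lᵐᵒᵖ) ℤ) : ChainComplex (ModuleCat.{u} Nᵐᵒᵖ) ℤ :=
  ((extendScalarsNC φ.op).mapHomologicalComplex _).obj C

/-! ### Finite domination -/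

/-- The chain complex has vanishing homology in all degrees. -/
def HasTrivialHomology {A : Type u} [Ring A] (C : ChainComplex (ModuleCat.{u} A) ℤ) : Prop :=
  ∀ n : ℤ, Limits.IsZero (C.homology n)

/-- A chain complex is bounded if it is zero outside a finite range of degrees. -/
def IsBoundedComplex {A : Type u} [Ring A] (C : ChainComplex (ModuleCat.{u} A) ℤ) : Prop :=
  ∃ a b : ℤ, ∀ n : ℤ, n < a ∨ b < n → Limits.IsZero (C.X n)

/-- A bounded chain complex of finitely generated free modules. -/
def IsBoundedFGFree {A : Type u} [Ring A] (C : ChainComplex (ModuleCat.{u} A) ℤ) : Prop :=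
  IsBoundedComplex C ∧ ∀ n : ℤ, Module.Finite A (C.X n) ∧ Module.Free A (C.X n)

/-- A bounded chain complex of finitely generated projective modules. -/
def IsBoundedFGProjective {A : Type u} [Ring A] (C : ChainComplex (ModuleCat.{u} A) ℤ) : Prop :=
  IsBoundedComplex C ∧ ∀ n : ℤ, Module.Finite A (C.X n) ∧ Module.Projective A (C.X n)

/-- For a subring `K` of `L`, a complex of right `L`-modules considered as a complex of right
`K`-modules. -/
noncomputable def restrictComplex {L : Type u} [Ring L] (K : Subring L)
    (C : ChainComplex (ModuleCat.{u} Lᵐᵒᵖ) ℤ) : ChainComplex (ModuleCat.{u} Kᵐᵒᵖ) ℤ :=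
  ((ModuleCat.restrictScalars K.subtype.op).mapHomologicalComplex _).obj C

/-- A complex `C` of right `L`-modules is `K`-finitely dominated if, considered as a complex of
right `K`-modules, it is a retract up to homotopy of a bounded complex `D` of finitely generated
free `K`-modules: there are chain maps `i : C → D` and `r : D → C` with `r ∘ i ≃ id`. -/
def IsFinitelyDominated {L : Type u} [Ring L] (K : Subring L)
    (C : ChainComplex (ModuleCat.{u} Lᵐᵒᵖ) ℤ) : Prop :=
  ∃ D : ChainComplex (ModuleCat.{u} Kᵐᵒᵖ) ℤ, IsBoundedFGFree D ∧
    ∃ (i : restrictComplex K C ⟶ D) (r : D ⟶ restrictComplex K C),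
      Nonempty (Homotopy (i ≫ r) (𝟙 (restrictComplex K C)))

/-- A complex of right `L`-modules is, considered as a complex of right `K`-modules, homotopy
equivalent to a bounded complex of finitely generated projective `K`-modules. -/
def IsHomotopyEquivFGProjective {L : Type u} [Ring L] (K : Subring L)
    (C : ChainComplex (ModuleCat.{u} Lᵐᵒᵖ) ℤ) : Prop :=
  ∃ D : ChainComplex (ModuleCat.{u} Kᵐᵒᵖ) ℤ, IsBoundedFGProjective D ∧
    Nonempty (HomotopyEquiv (restrictComplex K C) D)

/-! ### Chain complexes of modules in terms of elements -/

namespace ModuleComplex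

variable {A : Type u} [Ring A]

/-! Write `L = ⨁ R_k`. Three conditions are linked in a cycle: equivalence over `R_0` to a bounded
complex of finitely generated projectives, finite domination, and acyclicity of both completions.
The first implies the second because projectives are summands of free modules
(`exists_free_retract`).

Domination implies acyclicity. Put `N = R((t))`. Strong grading gives `∑ x_j y_j = 1` with `x_j ∈
R_{-1}`, `y_j ∈ R_1`, and `T (m ⊗ n) = ∑ m x_j ⊗ y_j n` on `C ⊗_{R_0} N` replaces `t⁻¹ ⊗ t`. The
sequence `0 → C ⊗_{R_0} N → C ⊗_{R_0} N → C ⊗_L N → 0` with first map `1 - T` is exact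
(`exists_of_proj_eq_zero`, `eq_zero_of_twist_eq`). If `C` is a homotopy retract of `D` via `i` and
`r`, then `i T r` on `D ⊗ N` is a matrix of elements of degree one, so `1 - i T r` is invertible by
a geometric series (`bijective_sub_of_degree_one`). As `r i ≃ 1`, invertibility on `D` forces the
cokernel of `1 - T` to be acyclic (`hasTrivialHomology_of_bijective`). Reversing the grading treats
`R((t⁻¹))`.

Acyclicity implies finiteness. Each completion of `C` has a contraction. Cutting it off at a
suitable degree yields `R_0`-linear maps `G`, `G'` on `C` that contract it up to elements of degrees
bounded below, respectively above (`exists_truncated_contraction`). Then `1 - d(G + G') - (G + G')d`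
is homotopic to the identity and lands in a band of finitely many degrees, which is finitely
generated over `R_0`. So `C` is a homotopy retract of a complex of finitely generated modules. As
`C` is projective over `R_0` (`IsStronglyGraded.projective`), its modules can be replaced by
finitely generated projectives degree by degree (`IsHomotopyRetract.exists_homotopyEquiv`). -/

theorem d_d {X : ChainComplex (ModuleCat.{u} A) ℤ} (i j k : ℤ) (x : X.X i) :
    (X.d j k).hom ((X.d i j).hom x) = 0 := by
  rw [← LinearMap.comp_apply, ← ModuleCat.hom_comp, X.d_comp_d]; rfl

theorem map_d {X Y : ChainComplex (ModuleCat.{u} A) ℤ} (f : X ⟶ Y) (i j : ℤ) (x : X.X i) :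
    (f.f j).hom ((X.d i j).hom x) = (Y.d i j).hom ((f.f i).hom x) := by
  rw [← LinearMap.comp_apply, ← ModuleCat.hom_comp, ← f.comm]; rfl

theorem hasTrivialHomology_iff (X : ChainComplex (ModuleCat.{u} A) ℤ) :
    HasTrivialHomology X ↔ ∀ (n : ℤ) (x : X.X (n + 1)), (X.d (n + 1) n).hom x = 0 →
      ∃ y : X.X (n + 1 + 1), (X.d (n + 1 + 1) (n + 1)).hom y = x := by
  have key (n : ℤ) : Limits.IsZero (X.homology (n + 1)) ↔
      ∀ x : X.X (n + 1), (X.d (n + 1) n).hom x = 0 →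
        ∃ y : X.X (n + 1 + 1), (X.d (n + 1 + 1) (n + 1)).hom y = x := by
    rw [← HomologicalComplex.exactAt_iff_isZero_homology,
      HomologicalComplex.exactAt_iff' X (n + 1 + 1) (n + 1) n
        ((ComplexShape.down ℤ).prev_eq' rfl) ((ComplexShape.down ℤ).next_eq' rfl),
      ShortComplex.moduleCat_exact_iff]
    rfl
  refine ⟨fun h n => (key n).1 (h _), fun h n => ?_⟩
  obtain ⟨m, rfl⟩ : ∃ m, n = m + 1 := ⟨n - 1, by ring⟩
  exact (key m).2 (h m)

/-- A homotopy from a family of maps raising the degree by one. -/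
noncomputable def homotopyOfMaps {X Y : ChainComplex (ModuleCat.{u} A) ℤ} {f g : X ⟶ Y}
    (s : ∀ n : ℤ, X.X n →ₗ[A] Y.X (n + 1))
    (h : ∀ (n : ℤ) (x : X.X (n + 1)), (f.f (n + 1)).hom x =
      s n ((X.d (n + 1) n).hom x) + (Y.d (n + 1 + 1) (n + 1)).hom (s (n + 1) x) +
        (g.f (n + 1)).hom x) :
    Homotopy f g where
  hom i j := if hij : i + 1 = j then ModuleCat.ofHom (s i) ≫ eqToHom (by rw [hij]) else 0
  zero i j hij := dif_neg hij
  comm i := by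
    obtain ⟨n, rfl⟩ : ∃ n, i = n + 1 := ⟨i - 1, by ring⟩
    rw [dNext_eq _ (show (ComplexShape.down ℤ).Rel (n + 1) n from rfl),
      prevD_eq _ (show (ComplexShape.down ℤ).Rel (n + 1 + 1) (n + 1) from rfl)]
    ext x
    simpa using h n x

theorem homotopy_apply {X Y : ChainComplex (ModuleCat.{u} A) ℤ} {f g : X ⟶ Y}
    (h : Homotopy f g) (n : ℤ) (x : X.X (n + 1)) :
    (f.f (n + 1)).hom x = (h.hom n (n + 1)).hom ((X.d (n + 1) n).hom x) +
      (Y.d (n + 1 + 1) (n + 1)).hom ((h.hom (n + 1) (n + 1 + 1)).hom x) +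
        (g.f (n + 1)).hom x := by
  rw [h.comm, dNext_eq _ (show (ComplexShape.down ℤ).Rel (n + 1) n from rfl),
      prevD_eq _ (show (ComplexShape.down ℤ).Rel (n + 1 + 1) (n + 1) from rfl)]
  rfl

/-- A bounded complex of projective modules without homology is contractible. -/
theorem exists_contraction {X : ChainComplex (ModuleCat.{u} A) ℤ} (hb : IsBoundedComplex X)
    (hp : ∀ n, Module.Projective A (X.X n)) (hX : HasTrivialHomology X) :
    ∃ s : ∀ n : ℤ, X.X n →ₗ[A] X.X (n + 1), ∀ (n : ℤ) (x : X.X (n + 1)),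
      x = s n ((X.d (n + 1) n).hom x) + (X.d (n + 1 + 1) (n + 1)).hom (s (n + 1) x) := by
  rw [hasTrivialHomology_iff] at hX
  obtain ⟨a, b, hab⟩ := hb
  have hsub (n : ℤ) (hn : n < a ∨ b < n) : Subsingleton (X.X n) :=
    ModuleCat.subsingleton_of_isZero (hab n hn)
  have key (k : ℕ) : ∃ s : ∀ n : ℤ, X.X n →ₗ[A] X.X (n + 1), ∀ n : ℤ, n < a + k →
      ∀ x : X.X (n + 1), n + 1 < a + k → x = s n ((X.d (n + 1) n).hom x) +
        (X.d (n + 1 + 1) (n + 1)).hom (s (n + 1) x) := by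
    induction k with
    | zero =>
      refine ⟨fun n => 0, fun n hn x hn' => ?_⟩
      have := hsub (n + 1) (Or.inl (by simpa using hn'))
      exact Subsingleton.elim _ _
    | succ k ih =>
      obtain ⟨s, hs⟩ := ih
      obtain ⟨m, hm⟩ : ∃ m : ℤ, m + 1 = a + k := ⟨a + k - 1, by ring⟩
      -- The identity one degree lower makes `1 - s d` take values in cycles. These are boundaries,
      -- so projectivity lifts the map through `d`; the lift is the next `s`.
      let φ : X.X (m + 1) →ₗ[A] X.X (m + 1) := LinearMap.id - s m ∘ₗ (X.d (m + 1) m).hom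
      have hφ (x) : (X.d (m + 1) m).hom (φ x) = 0 := by
        obtain ⟨l, rfl⟩ : ∃ l, m = l + 1 := ⟨m - 1, by ring⟩
        have := hs l (by omega) ((X.d (l + 1 + 1) (l + 1)).hom x) (by omega)
        rw [d_d, map_zero, zero_add] at this
        simp only [φ, LinearMap.sub_apply, LinearMap.id_apply, LinearMap.comp_apply, map_sub]
        rw [← this, sub_self]
      let dm : X.X (m + 1 + 1) →ₗ[A] LinearMap.ker (X.d (m + 1) m).hom :=
        (X.d (m + 1 + 1) (m + 1)).hom.codRestrict _ fun y => d_d _ _ _ y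
      have hdm : Function.Surjective dm := by
        rintro ⟨x, hx⟩
        obtain ⟨y, hy⟩ := hX m x hx
        exact ⟨y, Subtype.ext hy⟩
      have := hp (m + 1)
      obtain ⟨t, ht⟩ := Module.projective_lifting_property dm (φ.codRestrict _ hφ) hdm
      have ht' (x) : (X.d (m + 1 + 1) (m + 1)).hom (t x) = x - s m ((X.d (m + 1) m).hom x) :=
        congrArg Subtype.val (LinearMap.congr_fun ht x)
      refine ⟨Function.update s (m + 1) t, fun n _ x hn => ?_⟩
      rw [Function.update_of_ne (by push_cast at hn; omega)]
      by_cases h : n = m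
      · subst h
        rw [Function.update_self, ht']
        abel
      · rw [Function.update_of_ne (by omega)]
        exact hs n (by push_cast at hn; omega) x (by push_cast at hn; omega)
  obtain ⟨s, hs⟩ := key (b + 1 - a).toNat
  refine ⟨s, fun n x => ?_⟩
  by_cases h : b < n + 1
  · have := hsub (n + 1) (Or.inr h)
    exact Subsingleton.elim _ _
  · exact hs n (by omega) x (by omega)

end ModuleComplex

/-! ### Balanced tensor products -/

namespace BalancedTensor

variable {A B : Type u} [Ring A] [Ring B] (f : A →+* B)
variable {M : Type u} [AddCommGroup M] [Module A M]

/-- The class of `b ⊗ m` in `B ⊗_A M`. -/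
noncomputable def tmul (b : B) (m : M) : BalancedTensor f M :=
  (balancedRel f M).mkQ (b ⊗ₜ[ℤ] m)

theorem tmul_add (b : B) (m m' : M) : tmul f b (m + m') = tmul f b m + tmul f b m' := by
  simp [tmul, TensorProduct.tmul_add]

theorem add_tmul (b b' : B) (m : M) : tmul f (b + b') m = tmul f b m + tmul f b' m := by
  simp [tmul, TensorProduct.add_tmul]

theorem smul_tmul (b b' : B) (m : M) : b' • tmul f b m = tmul f (b' * b) m := by
  rw [tmul, ← map_smul]; rfl

theorem tmul_smul (b : B) (a : A) (m : M) : tmul f b (a • m) = tmul f (b * f a) m := by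
  symm
  rw [← sub_eq_zero, tmul, tmul, ← map_sub, Submodule.mkQ_apply, Submodule.Quotient.mk_eq_zero]
  exact Submodule.subset_span ⟨b, a, m, rfl⟩

theorem tmul_eq_smul (b : B) (m : M) : tmul f b m = b • tmul f 1 m := by
  rw [smul_tmul, mul_one]

@[simp] theorem map_tmul {N : Type u} [AddCommGroup N] [Module A N] (g : M →ₗ[A] N) (b : B)
    (m : M) : BalancedTensor.map f g (tmul f b m) = tmul f b (g m) := rfl

/-- The additive map `M → B ⊗_A M`. -/
noncomputable def unit : M →+ BalancedTensor f M where
  toFun m := tmul f 1 m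
  map_zero' := by simp [tmul]
  map_add' := tmul_add f 1

theorem unit_apply (m : M) : unit f m = tmul f 1 m := rfl

@[elab_as_elim]
theorem induction_on {p : BalancedTensor f M → Prop} (z : BalancedTensor f M) (h0 : p 0)
    (ht : ∀ b m, p (tmul f b m)) (ha : ∀ x y, p x → p y → p (x + y)) : p z := by
  obtain ⟨z, rfl⟩ := Submodule.mkQ_surjective _ z
  induction z using TensorProduct.induction_on with
  | zero => simpa using h0
  | tmul b m => exact ht b m
  | add x y hx hy => rw [map_add]; exact ha _ _ hx hy

variable {P : Type u} [AddCommGroup P] [Module B P]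

/-- The universal property of `B ⊗_A M`. -/
noncomputable def lift (g : M →+ P) (hg : ∀ (a : A) (m : M), g (a • m) = f a • g m) :
    BalancedTensor f M →ₗ[B] P :=
  (balancedRel f M).liftQ
    (TensorProduct.AlgebraTensorModule.lift
      { toFun := fun b => b • (g.toIntLinearMap : M →ₗ[ℤ] P)
        map_add' := fun b b' => by ext; simp [add_smul]
        map_smul' := fun b b' => by ext; simp [mul_smul] })
    (by
      rw [balancedRel, Submodule.span_le]
      rintro _ ⟨b, a, m, rfl⟩
      simp [hg, mul_smul])

@[simp] theorem lift_tmul (g : M →+ P) (hg : ∀ (a : A) (m : M), g (a • m) = f a • g m)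
    (b : B) (m : M) : lift f g hg (tmul f b m) = b • g m := by
  simp [lift, tmul]

theorem ext_unit {g h : BalancedTensor f M →ₗ[B] P}
    (H : ∀ m : M, g (tmul f 1 m) = h (tmul f 1 m)) : g = h := by
  refine hom_ext f fun b m => ?_
  change g (tmul f b m) = h (tmul f b m)
  rw [tmul_eq_smul, map_smul, map_smul, H]

/-- The coordinates of elements of `B ⊗_A M` with respect to a basis of `M`. -/
noncomputable def coordHom {ι : Type*} (b : Module.Basis ι A M) :
    BalancedTensor f M →ₗ[B] (ι → B) :=
  LinearMap.pi fun i => lift f (f.toAddMonoidHom.comp (b.coord i).toAddMonoidHom)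
    (fun a m => by simp)

theorem coordHom_tmul {ι : Type*} (b : Module.Basis ι A M) (x : B) (m : M) (i : ι) :
    coordHom f b (tmul f x m) i = x * f (b.repr m i) := by
  simp [coordHom]

/-- For a free module `M` with finite basis, the tensor product `B ⊗_A M` is free. -/
noncomputable def coord {ι : Type*} [Finite ι] (b : Module.Basis ι A M) :
    BalancedTensor f M ≃ₗ[B] (ι → B) :=
  letI := Fintype.ofFinite ι
  LinearEquiv.ofLinearMap (coordHom f b) (Fintype.linearCombination B fun i => tmul f 1 (b i))
    (by
      classical
      refine LinearMap.pi_ext' fun i => LinearMap.ext_ring ?_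
      ext j
      by_cases h : i = j
      · subst h; simp [coordHom_tmul]
      · simp [coordHom_tmul, Ne.symm h])
    (ext_unit f fun m => by
      simp only [LinearMap.comp_apply, LinearMap.id_apply, Fintype.linearCombination_apply]
      conv_rhs => rw [← b.sum_repr m]
      change _ = unit f _
      rw [map_sum]
      refine Finset.sum_congr rfl fun i _ => ?_
      rw [unit_apply, tmul_smul, tmul_eq_smul f (1 * _), coordHom_tmul])

theorem coord_tmul {ι : Type*} [Finite ι] (b : Module.Basis ι A M) (x : B) (m : M) (i : ι) :
    coord f b (tmul f x m) i = x * f (b.repr m i) :=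
  coordHom_tmul f b x m i

end BalancedTensor

/-! ### Finitely generated models of homotopy retracts -/

namespace ModuleComplex

variable {A : Type u} [Ring A]

/-- A bounded complex of finitely generated projective modules is a retract of a bounded complex
of finitely generated free modules. -/
theorem exists_free_retract {E : ChainComplex (ModuleCat.{u} A) ℤ} (hE : IsBoundedFGProjective E) :
    ∃ D : ChainComplex (ModuleCat.{u} A) ℤ, IsBoundedFGFree D ∧
      ∃ (i : E ⟶ D) (r : D ⟶ E), i ≫ r = 𝟙 E := by
  obtain ⟨⟨a, b, hab⟩, hfg⟩ := hE
  have key (n : ℤ) : ∃ (m : ℕ) (p : (Fin m → A) →ₗ[A] E.X n) (s : E.X n →ₗ[A] (Fin m → A)),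
      p ∘ₗ s = LinearMap.id ∧ (Limits.IsZero (E.X n) → m = 0) := by
    obtain ⟨_, _⟩ := hfg n
    -- Zero modules are covered by `A^0`, so that the free complex stays bounded.
    by_cases h : Limits.IsZero (E.X n)
    · have := ModuleCat.subsingleton_of_isZero h
      exact ⟨0, 0, 0, LinearMap.ext fun x => Subsingleton.elim _ _, fun _ => rfl⟩
    · obtain ⟨m, p, hp⟩ := Module.Finite.exists_fin' A (E.X n)
      obtain ⟨s, hs⟩ := Module.projective_lifting_property p LinearMap.id hp
      exact ⟨m, p, s, hs, fun h' => (h h').elim⟩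
  choose m p s hps hm using key
  have hps' (n : ℤ) (x : E.X n) : p n (s n x) = x := LinearMap.congr_fun (hps n) x
  let D : ChainComplex (ModuleCat.{u} A) ℤ :=
    { X := fun n => ModuleCat.of A (Fin (m n) → A)
      -- Because `p s = 1`, this differential squares to zero, and both `s` and `p` are chain maps.
      d := fun i j => ModuleCat.ofHom (s j ∘ₗ (E.d i j).hom ∘ₗ p i)
      shape := fun i j h => by ext; simp [E.shape i j h]
      d_comp_d' := fun i j k _ _ => by
        refine ModuleCat.hom_ext (LinearMap.ext fun x => ?_)
        change s k ((E.d j k).hom (p j (s j ((E.d i j).hom (p i x))))) = 0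
        rw [hps', d_d, map_zero] }
  refine ⟨D, ⟨⟨a, b, fun n hn => ?_⟩, fun n => ⟨?_, ?_⟩⟩,
    { f := fun n => ModuleCat.ofHom (s n)
      comm' := fun i j _ => ?_ }, { f := fun n => ModuleCat.ofHom (p n), comm' := fun i j _ => ?_ },
    ?_⟩
  · have : IsEmpty (Fin (m n)) := by rw [hm n (hab n hn)]; infer_instance
    exact @ModuleCat.isZero_of_subsingleton _ _ _ (inferInstanceAs (Subsingleton (Fin (m n) → A)))
  · exact inferInstanceAs (Module.Finite A (Fin (m n) → A))
  · exact inferInstanceAs (Module.Free A (Fin (m n) → A))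
  · refine ModuleCat.hom_ext (LinearMap.ext fun x => ?_)
    change s j ((E.d i j).hom (p i (s i x))) = s j ((E.d i j).hom x)
    rw [hps']
  · refine ModuleCat.hom_ext (LinearMap.ext fun x => ?_)
    change (E.d i j).hom (p i x) = p j (s j ((E.d i j).hom (p i x)))
    rw [hps']
  · ext n x
    exact hps' n x

/-- The complex `X` is a retract of `D` up to homotopy. -/
def IsHomotopyRetract (X D : ChainComplex (ModuleCat.{u} A) ℤ) : Prop :=
  ∃ (i : X ⟶ D) (r : D ⟶ X), Nonempty (Homotopy (i ≫ r) (𝟙 X))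

theorem IsHomotopyRetract.of_homotopyEquiv {X Y D : ChainComplex (ModuleCat.{u} A) ℤ}
    (h : IsHomotopyRetract X D) (e : HomotopyEquiv X Y) : IsHomotopyRetract Y D := by
  obtain ⟨i, r, ⟨H⟩⟩ := h
  refine ⟨e.inv ≫ i, r ≫ e.hom, ⟨?_⟩⟩
  refine (Homotopy.ofEq ?_).trans
    (((H.compRight e.hom).compLeft e.inv).trans ((Homotopy.ofEq ?_).trans e.homotopyInvHomId))
  · simp
  · simp

/-! ### Replacing one module of a complex up to homotopy -/

variable (Y : ChainComplex (ModuleCat.{u} A) ℤ) (n : ℤ) {F : Type u} [AddCommGroup F] [Module A F]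
  (ψ : ∀ j : ℤ, F →ₗ[A] Y.X j)

/-- The submodule of `Y_j × F` consisting of the pairs `(ψ f, f)` for `j = n`, of the pairs
`(y, f)` with `d y = - ψ f` for `j = n + 1`, and of the pairs `(y, 0)` in all other degrees. -/
def coverSubmodule (j : ℤ) : Submodule A (Y.X j × F) where
  -- Carving every degree out of `Y_j × F` avoids modules defined by cases on `j`.
  carrier := {z | (j = n → z.1 = ψ j z.2) ∧ (j = n + 1 → (Y.d j n).hom z.1 = -ψ n z.2) ∧
    (j ≠ n → j ≠ n + 1 → z.2 = 0)}
  zero_mem' := by simp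
  add_mem' {z w} hz hw := by
    refine ⟨fun h => ?_, fun h => ?_, fun h h' => ?_⟩
    · simp [hz.1 h, hw.1 h]
    · simp [hz.2.1 h, hw.2.1 h, add_comm]
    · simp [hz.2.2 h h', hw.2.2 h h']
  smul_mem' c z hz := by
    refine ⟨fun h => ?_, fun h => ?_, fun h h' => ?_⟩
    · simp [hz.1 h]
    · simp [hz.2.1 h]
    · simp [hz.2.2 h h']

/-- The differential `(y, f) ↦ (d y, -f)` in degree `n + 1` and `(y, f) ↦ (d y, 0)` elsewhere. -/
noncomputable def coverD (i j : ℤ) : Y.X i × F →ₗ[A] Y.X j × F :=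
  ((Y.d i j).hom ∘ₗ LinearMap.fst A _ _).prod
    (if i = n + 1 ∧ j = n then - LinearMap.snd A _ _ else 0)

theorem coverD_apply (i j : ℤ) (z : Y.X i × F) : coverD Y n i j z =
    ((Y.d i j).hom z.1, if i = n + 1 ∧ j = n then -z.2 else 0) := by
  unfold coverD
  split_ifs <;> rfl

theorem coverD_mem (i j : ℤ) (hij : j + 1 = i) (z : Y.X i × F) (hz : z ∈ coverSubmodule Y n ψ i) :
    coverD Y n i j z ∈ coverSubmodule Y n ψ j := by
  rw [coverD_apply]
  refine ⟨fun h => ?_, fun h => ?_, fun h h' => ?_⟩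
  · subst h
    simp [hz.2.1 hij.symm, hij]
  · rw [if_neg (by omega)]
    simp [d_d]
  · rw [if_neg (by omega)]

/-- The complex obtained from `Y` by replacing `Y_n` by `F`, and `Y_{n+1}` by the pullback of
`Y_{n+1} → Y_n ← F`. -/
noncomputable def coverComplex : ChainComplex (ModuleCat.{u} A) ℤ where
  X j := ModuleCat.of A (coverSubmodule Y n ψ j)
  d i j := if h : j + 1 = i then
    ModuleCat.ofHom ((coverD Y n i j).restrict (coverD_mem Y n ψ i j h)) else 0
  shape i j h := dif_neg h
  d_comp_d' i j k hij hjk := by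
    change j + 1 = i at hij
    change k + 1 = j at hjk
    rw [dif_pos hij, dif_pos hjk]
    refine ModuleCat.hom_ext (LinearMap.ext fun z => Subtype.ext ?_)
    change coverD Y n j k (coverD Y n i j z.1) = 0
    rw [coverD_apply, coverD_apply, d_d]
    split_ifs <;> first | omega | simp

theorem coverComplex_d_apply (j : ℤ) (z : coverSubmodule Y n ψ (j + 1)) :
    (((coverComplex Y n ψ).d (j + 1) j).hom z : coverSubmodule Y n ψ j) =
      ⟨((Y.d (j + 1) j).hom z.1.1, if j = n then -z.1.2 else 0), by
        have := coverD_mem Y n ψ (j + 1) j rfl z.1 z.2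
        rw [coverD_apply] at this
        simpa using this⟩ := by
  refine Subtype.ext ?_
  simp only [coverComplex, dif_pos]
  change coverD Y n (j + 1) j z.1 = _
  rw [coverD_apply]
  simp

variable (σ : ∀ i j : ℤ, Y.X i →ₗ[A] Y.X j) (τ : ∀ j : ℤ, Y.X j →ₗ[A] F)

/-- The map `Y_j → Y_j × F` underlying the homotopy inverse of the projection. -/
noncomputable def coverInv (k j : ℤ) : Y.X j →ₗ[A] Y.X j × F :=
  (LinearMap.id - (Y.d (j + 1) j).hom ∘ₗ σ j (j + 1) - σ k j ∘ₗ (Y.d j k).hom).prod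
    (τ j - τ k ∘ₗ (Y.d j k).hom)

theorem coverInv_apply (k j : ℤ) (y : Y.X j) : coverInv Y σ τ k j y =
    (y - (Y.d (j + 1) j).hom (σ j (j + 1) y) - σ k j ((Y.d j k).hom y),
      τ j y - τ k ((Y.d j k).hom y)) := rfl

variable {Y n ψ σ τ}

/-- The pair `σ`, `τ` splits `(d, ψ) : Y_{n+1} × F → Y_n`. In degree `n` the condition reads `y - d
σ y = ψ τ y`; in degree `n + 1` it is the same identity applied to `d y`. Only `σ n (n + 1)` and `τ
n` matter; indexing over all degrees spares transports. -/
theorem coverInv_mem (hστ : ∀ y, (Y.d (n + 1) n).hom (σ n (n + 1) y) + ψ n (τ n y) = y)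
    (hσ : ∀ i j, i ≠ n → σ i j = 0) (hτ : ∀ j, j ≠ n → τ j = 0) (k j : ℤ) (hkj : k + 1 = j)
    (y : Y.X j) : coverInv Y σ τ k j y ∈ coverSubmodule Y n ψ j := by
  subst hkj
  rw [coverInv_apply]
  refine ⟨fun h => ?_, fun h => ?_, fun h h' => ?_⟩
  · subst h
    rw [hσ k _ (by omega), hτ k (by omega)]
    have := hστ y
    simp only [LinearMap.zero_apply, sub_zero]
    rw [sub_eq_iff_eq_add', this]
  · obtain rfl : k = n := by omega
    rw [hσ _ _ (show k + 1 ≠ k by omega), hτ _ (show k + 1 ≠ k by omega)]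
    simp only [LinearMap.zero_apply, zero_sub, map_neg, map_sub, map_zero, sub_zero, neg_neg]
    rw [sub_eq_iff_eq_add', hστ]
  · simp [hτ _ h, hτ k (by omega)]

/-- The homotopy on the new complex, in degree `j`. -/
noncomputable def coverHomotopy (j : ℤ) : Y.X j × F →ₗ[A] Y.X (j + 1) × F :=
  (σ j (j + 1) ∘ₗ LinearMap.fst A _ _).prod
    (τ j ∘ₗ LinearMap.fst A _ _ - if j = n then LinearMap.snd A _ _ else 0)

theorem coverHomotopy_apply (j : ℤ) (z : Y.X j × F) :
    coverHomotopy (n := n) (σ := σ) (τ := τ) j z =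
      (σ j (j + 1) z.1, τ j z.1 - if j = n then z.2 else 0) := by
  unfold coverHomotopy
  split_ifs <;> rfl

theorem coverHomotopy_mem (hστ : ∀ y, (Y.d (n + 1) n).hom (σ n (n + 1) y) + ψ n (τ n y) = y)
    (hσ : ∀ i j, i ≠ n → σ i j = 0) (hτ : ∀ j, j ≠ n → τ j = 0) (j : ℤ)
    (z : Y.X j × F) (hz : z ∈ coverSubmodule Y n ψ j) :
    coverHomotopy (n := n) (σ := σ) (τ := τ) j z ∈ coverSubmodule Y n ψ (j + 1) := by
  rw [coverHomotopy_apply]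
  refine ⟨fun h => ?_, fun h => ?_, fun h h' => ?_⟩
  · rw [hσ _ _ (show j ≠ n by omega), hτ _ (show j ≠ n by omega), if_neg (by omega)]
    simp
  · obtain rfl : j = n := by omega
    have := hz.1 rfl
    rw [if_pos rfl, map_sub, ← this, neg_sub, eq_sub_iff_add_eq]
    exact hστ _
  · rw [hτ _ (show j ≠ n by omega), if_neg (by omega)]
    simp

variable (Y n ψ) in
/-- The projection of `coverComplex` to the original complex. -/
noncomputable def coverProj : coverComplex Y n ψ ⟶ Y where
  f j := ModuleCat.ofHom (LinearMap.fst A _ _ ∘ₗ (coverSubmodule Y n ψ j).subtype)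
  comm' := by
    rintro _ j rfl
    refine ModuleCat.hom_ext (LinearMap.ext fun z => ?_)
    exact (congrArg (fun z : coverSubmodule Y n ψ j => z.1.1)
      (coverComplex_d_apply Y n ψ j z)).symm

/-- The homotopy inverse of the projection. -/
noncomputable def coverSection
    (hστ : ∀ y, (Y.d (n + 1) n).hom (σ n (n + 1) y) + ψ n (τ n y) = y)
    (hσ : ∀ i j, i ≠ n → σ i j = 0) (hτ : ∀ j, j ≠ n → τ j = 0) :
    Y ⟶ coverComplex Y n ψ where
  f j := ModuleCat.ofHom ((coverInv Y σ τ (j - 1) j).codRestrict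
    (coverSubmodule Y n ψ j) (coverInv_mem hστ hσ hτ (j - 1) j (by ring)))
  comm' := by
    rintro _ j rfl
    refine ModuleCat.hom_ext (LinearMap.ext fun y => ?_)
    refine (coverComplex_d_apply Y n ψ j _).trans (Subtype.ext ?_)
    change ((Y.d (j + 1) j).hom (coverInv Y σ τ (j + 1 - 1) (j + 1) y).1,
      if j = n then -(coverInv Y σ τ (j + 1 - 1) (j + 1) y).2 else 0) =
        coverInv Y σ τ (j - 1) j ((Y.d (j + 1) j).hom y)
    rw [add_sub_cancel_right, coverInv_apply, coverInv_apply]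
    refine Prod.ext ?_ ?_
    · simp [d_d]
    · by_cases h : j = n
      · simp [h, d_d, hτ (j + 1) (by omega)]
      · simp [h, d_d, hτ j h]

/-- The complex `coverComplex` is homotopy equivalent to the original one. -/
noncomputable def coverEquiv
    (hστ : ∀ y, (Y.d (n + 1) n).hom (σ n (n + 1) y) + ψ n (τ n y) = y)
    (hσ : ∀ i j, i ≠ n → σ i j = 0) (hτ : ∀ j, j ≠ n → τ j = 0) :
    HomotopyEquiv (coverComplex Y n ψ) Y where
  hom := coverProj Y n ψ
  inv := coverSection hστ hσ hτ
  homotopyHomInvId := by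
    let s (j : ℤ) : coverSubmodule Y n ψ j →ₗ[A] coverSubmodule Y n ψ (j + 1) :=
      -(coverHomotopy (n := n) (σ := σ) (τ := τ) j).restrict (coverHomotopy_mem hστ hσ hτ j)
    refine homotopyOfMaps s fun j z => Subtype.ext ?_
    obtain ⟨⟨y, f⟩, hz⟩ := z
    change coverInv Y σ τ (j + 1 - 1) (j + 1) y = _
    refine Eq.trans ?_ (congrArg₂ (fun (a : coverSubmodule Y n ψ j) (b : coverSubmodule Y n ψ (j + 1)) =>
      (s j a + b + ⟨(y, f), hz⟩ : coverSubmodule Y n ψ (j + 1)).1)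
      (coverComplex_d_apply Y n ψ j _).symm (coverComplex_d_apply Y n ψ (j + 1) _).symm)
    change _ = -coverHomotopy (n := n) (σ := σ) (τ := τ) j
        ((Y.d (j + 1) j).hom y, if j = n then -f else 0) +
      ((Y.d (j + 1 + 1) (j + 1)).hom
        (-coverHomotopy (n := n) (σ := σ) (τ := τ) (j + 1) (y, f)).1, if j + 1 = n then
          -(-coverHomotopy (n := n) (σ := σ) (τ := τ) (j + 1) (y, f)).2 else 0) + (y, f)
    rw [add_sub_cancel_right, coverInv_apply, coverHomotopy_apply, coverHomotopy_apply]
    refine Prod.ext ?_ ?_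
    · simp only [Prod.fst_add, Prod.fst_neg, map_neg]
      abel
    · simp only [Prod.snd_add, Prod.snd_neg]
      by_cases h : j = n
      · simp [h, hτ (j + 1) (by omega)]
      · by_cases h' : j + 1 = n
        · simp [h, h', hτ j h]
        · have : f = 0 := hz.2.2 h' (by omega)
          simp [h, h', this, hτ _ h, hτ _ h']
  homotopyInvHomId := by
    -- The composite is `1 - d σ - σ d` by construction.
    refine homotopyOfMaps (fun j => -σ j (j + 1)) fun j y => ?_
    change (coverInv Y σ τ (j + 1 - 1) (j + 1) y).1 = -σ j (j + 1) ((Y.d (j + 1) j).hom y) +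
      (Y.d (j + 1 + 1) (j + 1)).hom (-σ (j + 1) (j + 1 + 1) y) + y
    rw [add_sub_cancel_right, coverInv_apply, map_neg]
    dsimp only
    abel

/-- Every degree is a direct summand of `Y_j × F`: the graph of `ψ` in degree `n`, the kernel of the
split map `(d, ψ)` in degree `n + 1`, and a copy of `Y_j` elsewhere. -/
theorem coverSubmodule_projective [Module.Projective A F] (hY : ∀ j, Module.Projective A (Y.X j))
    (hστ : ∀ y, (Y.d (n + 1) n).hom (σ n (n + 1) y) + ψ n (τ n y) = y) (j : ℤ) :
    Module.Projective A (coverSubmodule Y n ψ j) := by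
  have := hY j
  suffices ∃ ρ : Y.X j × F →ₗ[A] Y.X j × F, (∀ z, ρ z ∈ coverSubmodule Y n ψ j) ∧
      ∀ z ∈ coverSubmodule Y n ψ j, ρ z = z by
    obtain ⟨ρ, h, h'⟩ := this
    exact Module.Projective.of_split (coverSubmodule Y n ψ j).subtype (ρ.codRestrict _ h)
      (LinearMap.ext fun z => Subtype.ext (h' z.1 z.2))
  by_cases h : j = n
  · subst h
    refine ⟨((ψ j).prod LinearMap.id) ∘ₗ LinearMap.snd A _ _, fun z => ?_, fun z hz => ?_⟩
    · refine ⟨fun _ => rfl, fun h => by omega, fun h => (h rfl).elim⟩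
    · exact Prod.ext (hz.1 rfl).symm rfl
  by_cases h' : j = n + 1
  · subst h'
    refine ⟨LinearMap.id - ((σ n (n + 1)).prod (τ n)) ∘ₗ
      ((Y.d (n + 1) n).hom ∘ₗ LinearMap.fst A _ _ + ψ n ∘ₗ LinearMap.snd A _ _),
      fun z => ?_, fun z hz => ?_⟩
    · refine ⟨fun h => by omega, fun _ => ?_, fun _ h => (h rfl).elim⟩
      have := hστ ((Y.d (n + 1) n).hom z.1 + ψ n z.2)
      simp only [LinearMap.sub_apply, LinearMap.id_apply, LinearMap.comp_apply,
        LinearMap.prod_apply, Function.prod_apply, LinearMap.add_apply, LinearMap.fst_apply,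
        LinearMap.snd_apply, Prod.fst_sub, Prod.snd_sub, map_sub] at this ⊢
      rw [← sub_eq_zero] at this ⊢
      rw [← neg_eq_zero, ← this]
      abel
    · have := hz.2.1 rfl
      simp [this]
  · refine ⟨LinearMap.inl A _ _ ∘ₗ LinearMap.fst A _ _, fun z => ?_, fun z hz => ?_⟩
    · exact ⟨fun e => (h e).elim, fun e => (h' e).elim, fun _ _ => rfl⟩
    · exact Prod.ext rfl (hz.2.2 h h').symm

theorem coverSubmodule_finite_self [Module.Finite A F] :
    Module.Finite A (coverSubmodule Y n ψ n) := by
  let ρ : F →ₗ[A] coverSubmodule Y n ψ n := ((ψ n).prod LinearMap.id).codRestrict _ fun f =>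
    ⟨fun _ => rfl, fun h => by omega, fun h => (h rfl).elim⟩
  refine Module.Finite.of_surjective ρ fun z => ⟨z.1.2, Subtype.ext ?_⟩
  exact Prod.ext (z.2.1 rfl).symm rfl

/-- The submodule is isomorphic to `Y_j` for `j ≠ n, n + 1`. -/
noncomputable def coverSubmoduleEquiv (j : ℤ) (h : j ≠ n) (h' : j ≠ n + 1) :
    Y.X j ≃ₗ[A] coverSubmodule Y n ψ j where
  toFun y := ⟨(y, 0), fun e => (h e).elim, fun e => (h' e).elim, fun _ _ => rfl⟩
  map_add' _ _ := Subtype.ext (Prod.ext rfl (add_zero 0).symm)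
  map_smul' _ _ := Subtype.ext (Prod.ext rfl (smul_zero _).symm)
  invFun z := z.1.1
  left_inv _ := rfl
  right_inv z := Subtype.ext (Prod.ext rfl (z.2.2.2 h h').symm)

/-- Let `Y` be a homotopy retract of a degreewise finitely generated complex. If `Y_{n-1}` is
finitely generated, then so is `Y_n` modulo boundaries. -/
theorem IsHomotopyRetract.exists_cover {Y D : ChainComplex (ModuleCat.{u} A) ℤ}
    (hYD : IsHomotopyRetract Y D) (hD : ∀ j, Module.Finite A (D.X j)) (n : ℤ)
    (hY : Module.Finite A (Y.X n)) :
    ∃ (m : ℕ) (ψ : (Fin m → A) →ₗ[A] Y.X (n + 1)),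
      ∀ y : Y.X (n + 1), ∃ f z, (Y.d (n + 1 + 1) (n + 1)).hom z + ψ f = y := by
  obtain ⟨i, r, ⟨H⟩⟩ := hYD
  have := hD (n + 1)
  -- From `r i = 1 + h d + d h`, each `y` is `r (i y) - h (d y)` up to a boundary, so `D_{n+1}` and
  -- `Y_n` supply enough generators.
  let φ : (D.X (n + 1) × Y.X n) →ₗ[A] Y.X (n + 1) :=
    (r.f (n + 1)).hom.coprod (H.hom n (n + 1)).hom
  obtain ⟨m, q, hq⟩ := Module.Finite.exists_fin' A (D.X (n + 1) × Y.X n)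
  refine ⟨m, φ ∘ₗ q, fun y => ?_⟩
  have := homotopy_apply H n y
  obtain ⟨f, hf⟩ := hq ((i.f (n + 1)).hom y, -(Y.d (n + 1) n).hom y)
  refine ⟨f, -(H.hom (n + 1) (n + 1 + 1)).hom y, ?_⟩
  rw [LinearMap.comp_apply, hf]
  change _ = (H.hom n (n + 1)).hom ((Y.d (n + 1) n).hom y) + _ + y at this
  simp only [φ, LinearMap.coprod_apply, map_neg]
  change (r.f (n + 1)).hom ((i.f (n + 1)).hom y) = _ at this
  rw [this]
  abel

/-- A bounded complex of projective modules that is a homotopy retract of a complex of finitely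
generated modules is homotopy equivalent to a bounded complex of finitely generated projective
modules. -/
theorem IsHomotopyRetract.exists_homotopyEquiv {X D : ChainComplex (ModuleCat.{u} A) ℤ}
    (hXD : IsHomotopyRetract X D) (hD : ∀ j, Module.Finite A (D.X j))
    (hb : IsBoundedComplex X) (hp : ∀ j, Module.Projective A (X.X j)) :
    ∃ E : ChainComplex (ModuleCat.{u} A) ℤ, IsBoundedFGProjective E ∧
      Nonempty (HomotopyEquiv X E) := by
  obtain ⟨a, b, hab⟩ := hb
  -- Finiteness is achieved from the bottom upwards. Treating one degree also changes the next, so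
  -- the process stops below `b`. The alternative `k = 0` admits `b < a`.
  have key (k : ℕ) (hk : k = 0 ∨ a + k ≤ b) : ∃ Y : ChainComplex (ModuleCat.{u} A) ℤ,
      Nonempty (HomotopyEquiv X Y) ∧
      (∀ j, j < a ∨ b < j → Subsingleton (Y.X j)) ∧
      (∀ j, Module.Projective A (Y.X j)) ∧ ∀ j < a + k, Module.Finite A (Y.X j) := by
    induction k with
    | zero =>
      refine ⟨X, ⟨HomotopyEquiv.refl X⟩, fun j hj => ModuleCat.subsingleton_of_isZero (hab j hj),
        hp, fun j hj => ?_⟩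
      have := ModuleCat.subsingleton_of_isZero (hab j (Or.inl (by simpa using hj)))
      infer_instance
    | succ k ih =>
      replace hk : a + k + 1 ≤ b := by omega
      obtain ⟨Y, ⟨e⟩, hY, hYp, hYf⟩ := ih (by omega)
      obtain ⟨n, hn⟩ : ∃ n : ℤ, n + 1 = a + k := ⟨a + k - 1, by ring⟩
      obtain ⟨m, ψ', hψ'⟩ := (hXD.of_homotopyEquiv e).exists_cover hD n (hYf n (by omega))
      obtain ⟨ψ, rfl⟩ : ∃ ψ : ∀ j, (Fin m → A) →ₗ[A] Y.X j, ψ (n + 1) = ψ' :=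
        ⟨Function.update 0 (n + 1) ψ', Function.update_self ..⟩
      have := hYp (n + 1)
      obtain ⟨ρ, hρ⟩ := Module.projective_lifting_property
        ((Y.d (n + 1 + 1) (n + 1)).hom.coprod (ψ (n + 1))) LinearMap.id fun y => by
          obtain ⟨f, z, h⟩ := hψ' y
          exact ⟨(z, f), h⟩
      obtain ⟨σ, hσ', hσ⟩ : ∃ σ : ∀ i j, Y.X i →ₗ[A] Y.X j,
          σ (n + 1) (n + 1 + 1) = LinearMap.fst A _ _ ∘ₗ ρ ∧ ∀ i j, i ≠ n + 1 → σ i j = 0 :=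
        ⟨Function.update 0 (n + 1) (Function.update 0 (n + 1 + 1) (LinearMap.fst A _ _ ∘ₗ ρ)),
          by simp, fun i j h => by rw [Function.update_of_ne h]; rfl⟩
      obtain ⟨τ, hτ', hτ⟩ : ∃ τ : ∀ j, Y.X j →ₗ[A] (Fin m → A),
          τ (n + 1) = LinearMap.snd A _ _ ∘ₗ ρ ∧ ∀ j, j ≠ n + 1 → τ j = 0 :=
        ⟨Function.update 0 (n + 1) (LinearMap.snd A _ _ ∘ₗ ρ), by simp,
          fun j h => by rw [Function.update_of_ne h]; rfl⟩
      have hστ (y) : (Y.d (n + 1 + 1) (n + 1)).hom (σ (n + 1) (n + 1 + 1) y) +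
          ψ (n + 1) (τ (n + 1) y) = y := by
        rw [hσ', hτ']
        exact LinearMap.congr_fun hρ y
      refine ⟨coverComplex Y (n + 1) ψ, ⟨e.trans (coverEquiv hστ hσ hτ).symm⟩, fun j hj => ?_,
        coverSubmodule_projective hYp hστ, fun j hj => ?_⟩
      · have := hY j hj
        exact (coverSubmoduleEquiv j (by omega) (by omega)).toEquiv.symm.subsingleton
      · push_cast at hj
        by_cases h : j = n + 1
        · subst h
          exact coverSubmodule_finite_self
        · have := hYf j (by omega)
          exact Module.Finite.equiv (coverSubmoduleEquiv j h (by omega))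
  obtain ⟨Y, he, hY, hYp, hYf⟩ := key (b - a).toNat (by omega)
  refine ⟨Y, ⟨⟨a, b, fun n hn => ?_⟩, fun j => ⟨?_, hYp j⟩⟩, he⟩
  · have := hY n hn
    exact ModuleCat.isZero_of_subsingleton _
  · by_cases h : j < a ∨ b < j
    · have := hY j h
      infer_instance
    by_cases h' : j < b
    · exact hYf j (by omega)
    -- Only `j = b` is left. Since `Y_{b+1} = 0` there are no boundaries, and the cover is onto.
    obtain ⟨n, rfl⟩ : ∃ n : ℤ, j = n + 1 := ⟨j - 1, by ring⟩
    obtain ⟨e⟩ := he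
    have hfin : Module.Finite A (Y.X n) := by
      by_cases ha : n < a
      · have := hY n (Or.inl ha)
        infer_instance
      · exact hYf n (by omega)
    obtain ⟨m, ψ, hψ⟩ := (hXD.of_homotopyEquiv e).exists_cover hD n hfin
    refine Module.Finite.of_surjective ψ fun y => ?_
    obtain ⟨f, z, hz⟩ := hψ y
    have := hY (n + 1 + 1) (by omega)
    rw [Subsingleton.elim z 0, map_zero, zero_add] at hz
    exact ⟨f, hz⟩

end ModuleComplex

/-! ### The mapping torus sequence for a change of base ring -/

namespace BalancedTensor

variable {A' A B : Type u} [Ring A'] [Ring A] [Ring B] (f : A' →+* A) (g : A →+* B)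
variable (M : Type u) [AddCommGroup M] [Module A M]

/-- The balanced tensor product `B ⊗_{A'} M` over `A'` of an `A`-module `M`. -/
abbrev Restricted : Type u :=
  letI := Module.compHom M f
  BalancedTensor (g.comp f) M

/-- The pure tensors in `B ⊗_{A'} M`. -/
noncomputable def rtmul (b : B) (m : M) : Restricted f g M :=
  letI := Module.compHom M f
  tmul (g.comp f) b m

theorem rtmul_smul (b : B) (a : A') (m : M) :
    rtmul f g M b (f a • m) = rtmul f g M (b * g (f a)) m :=
  letI := Module.compHom M f
  tmul_smul (g.comp f) b a m

theorem rtmul_add (b : B) (m m' : M) :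
    rtmul f g M b (m + m') = rtmul f g M b m + rtmul f g M b m' :=
  letI := Module.compHom M f
  tmul_add (g.comp f) b m m'

theorem add_rtmul (b b' : B) (m : M) :
    rtmul f g M (b + b') m = rtmul f g M b m + rtmul f g M b' m :=
  letI := Module.compHom M f
  add_tmul (g.comp f) b b' m

/-- The map `m ↦ b ⊗ m`. -/
noncomputable def rtmulHom (b : B) : M →+ Restricted f g M :=
  AddMonoidHom.mk' (rtmul f g M b) (rtmul_add f g M b)

/-- The map `b ↦ b ⊗ m`. -/
noncomputable def rtmulHom' (m : M) : B →+ Restricted f g M :=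
  AddMonoidHom.mk' (fun b => rtmul f g M b m) fun b b' => add_rtmul f g M b b' m

theorem rtmul_zero (b : B) : rtmul f g M b 0 = 0 := map_zero (rtmulHom f g M b)

theorem zero_rtmul (m : M) : rtmul f g M 0 m = 0 := map_zero (rtmulHom' f g M m)

theorem rtmul_sum {κ : Type*} (s : Finset κ) (b : B) (m : κ → M) :
    rtmul f g M b (∑ i ∈ s, m i) = ∑ i ∈ s, rtmul f g M b (m i) :=
  map_sum (rtmulHom f g M b) m s

theorem sum_rtmul {κ : Type*} (s : Finset κ) (b : κ → B) (m : M) :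
    rtmul f g M (∑ i ∈ s, b i) m = ∑ i ∈ s, rtmul f g M (b i) m :=
  map_sum (rtmulHom' f g M m) b s

theorem smul_rtmul (b b' : B) (m : M) : b' • rtmul f g M b m = rtmul f g M (b' * b) m :=
  letI := Module.compHom M f
  smul_tmul (g.comp f) b b' m

theorem rtmul_eq_smul (b : B) (m : M) : rtmul f g M b m = b • rtmul f g M 1 m := by
  rw [smul_rtmul, mul_one]

variable {f g M} in
@[elab_as_elim]
theorem Restricted.induction_on {p : Restricted f g M → Prop}
    (z : Restricted f g M) (h0 : p 0)
    (ht : ∀ b m, p (rtmul f g M b m)) (ha : ∀ x y, p x → p y → p (x + y)) : p z :=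
  letI := Module.compHom M f
  BalancedTensor.induction_on (g.comp f) z h0 ht ha

section
variable {P : Type u} [AddCommGroup P] [Module B P]

/-- The universal property of `B ⊗_{A'} M`. -/
noncomputable def rlift (h : M →+ P) (hh : ∀ a m, h (f a • m) = g (f a) • h m) :
    Restricted f g M →ₗ[B] P :=
  letI := Module.compHom M f
  lift (g.comp f) h hh

@[simp] theorem rlift_rtmul (h : M →+ P) (hh : ∀ a m, h (f a • m) = g (f a) • h m) (b : B)
    (m : M) : rlift f g M h hh (rtmul f g M b m) = b • h m :=
  letI := Module.compHom M f
  lift_tmul (g.comp f) h hh b m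

end

/-- The canonical map `B ⊗_{A'} M → B ⊗_A M`. -/
noncomputable def proj : Restricted f g M →ₗ[B] BalancedTensor g M :=
  rlift f g M (unit g) fun a m => by
    rw [unit_apply, unit_apply, tmul_smul, smul_tmul, one_mul, mul_one]

@[simp] theorem proj_rtmul (b : B) (m : M) : proj f g M (rtmul f g M b m) = tmul g b m := by
  rw [proj, rlift_rtmul]
  exact (tmul_eq_smul g b m).symm

theorem proj_surjective : Function.Surjective (proj f g M) := by
  intro z
  induction z using induction_on with
  | h0 => exact ⟨0, map_zero _⟩
  | ht b m => exact ⟨_, proj_rtmul f g M b m⟩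
  | ha x y hx hy =>
    obtain ⟨x, rfl⟩ := hx
    obtain ⟨y, rfl⟩ := hy
    exact ⟨x + y, map_add _ _ _⟩

variable {f}
variable {κ : Type} [Fintype κ] {u v : κ → A} (huv : ∑ j, v j * u j = 1)
  (hf : ∀ i j a, ∃ c, f c = u i * f a * v j)

/-- The endomorphism `b ⊗ m ↦ ∑ j, b g(v_j) ⊗ u_j m` of `B ⊗_{A'} M`. -/
noncomputable def twist : Restricted f g M →ₗ[B] Restricted f g M :=
  rlift f g M
    (AddMonoidHom.mk' (fun m : M => ∑ j, rtmul f g M (g (v j)) (u j • m)) fun m m' => by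
      simp only [smul_add, rtmul_add, Finset.sum_add_distrib])
    fun a m => by
      change ∑ j, rtmul f g M (g (v j)) (u j • f a • m) =
        g (f a) • ∑ j, rtmul f g M (g (v j)) (u j • m)
      -- Inserting `∑ v_j u_j = 1` turns `u_i a m` into `∑ (u_i a v_j) u_j m`. The bracket lies in
      -- `A'` and crosses the tensor sign, after which `∑ v_i u_i = 1` removes the index `i`.
      choose c hc using hf
      calc ∑ i, rtmul f g M (g (v i)) (u i • f a • m)
          = ∑ i, ∑ j, rtmul f g M (g (v i)) (f (c i j a) • u j • m) := by
            refine Finset.sum_congr rfl fun i _ => ?_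
            rw [← rtmul_sum]
            congr 1
            simp only [hc, ← mul_smul, mul_assoc]
            rw [← Finset.sum_smul, ← Finset.mul_sum, ← Finset.mul_sum, huv, mul_one]
        _ = ∑ i, ∑ j, rtmul f g M (g (v i * u i * (f a * v j))) (u j • m) := by
            simp only [rtmul_smul]
            simp only [hc, ← map_mul, mul_assoc]
        _ = g (f a) • ∑ j, rtmul f g M (g (v j)) (u j • m) := by
            rw [Finset.sum_comm, Finset.smul_sum]
            refine Finset.sum_congr rfl fun j _ => ?_
            rw [smul_rtmul, ← sum_rtmul, ← map_sum, ← Finset.sum_mul, huv, one_mul, map_mul]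

theorem twist_rtmul (b : B) (m : M) :
    twist g M huv hf (rtmul f g M b m) = ∑ j, rtmul f g M (b * g (v j)) (u j • m) := by
  refine (rlift_rtmul ..).trans ?_
  change b • ∑ j, rtmul f g M (g (v j)) (u j • m) = _
  simp only [Finset.smul_sum, smul_rtmul]

theorem twist_comm {M N : Type u} [AddCommGroup M] [Module A M] [AddCommGroup N] [Module A N]
    (φ : M →ₗ[A] N) (Φ : Restricted f g M →ₗ[B] Restricted f g N)
    (hΦ : ∀ b m, Φ (rtmul f g M b m) = rtmul f g N b (φ m)) (z : Restricted f g M) :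
    Φ (twist g M huv hf z) = twist g N huv hf (Φ z) := by
  induction z using Restricted.induction_on with
  | h0 => simp
  | ha z w hz hw => simp only [map_add, hz, hw]
  | ht b m => simp only [twist_rtmul, map_sum, hΦ, map_smul]

variable {g} in
theorem proj_comm {M N : Type u} [AddCommGroup M] [Module A M] [AddCommGroup N] [Module A N]
    (φ : M →ₗ[A] N) (Φ : Restricted f g M →ₗ[B] Restricted f g N)
    (hΦ : ∀ b m, Φ (rtmul f g M b m) = rtmul f g N b (φ m)) (z : Restricted f g M) :
    BalancedTensor.map g φ (proj f g M z) = proj f g N (Φ z) := by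
  induction z using Restricted.induction_on with
  | h0 => simp
  | ha z w hz hw => simp only [map_add, hz, hw]
  | ht b m => rw [proj_rtmul, hΦ, proj_rtmul, map_tmul]

theorem proj_twist (z : Restricted f g M) : proj f g M (twist g M huv hf z) = proj f g M z := by
  induction z using Restricted.induction_on with
  | h0 => simp
  | ha x y hx hy => simp [hx, hy]
  | ht b m =>
    rw [twist_rtmul, map_sum]
    simp only [proj_rtmul, tmul_smul, mul_assoc, ← map_mul]
    simp only [tmul_eq_smul g (_ * _), ← Finset.sum_smul]
    rw [← Finset.mul_sum, ← map_sum, huv, map_one, mul_one, ← tmul_eq_smul]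

/-- The kernel of `B ⊗_{A'} M → B ⊗_A M` is the image of `1 - twist`, if the ring `A` is generated
by elements of degrees `0`, `1` and `-1`. -/
theorem exists_of_proj_eq_zero
    (hA : Subring.closure (Set.range f ∪ ({l | ∀ j, ∃ c, f c = u j * l} ∪
      {l | ∀ j, ∃ c, f c = l * v j})) = ⊤) (z : Restricted f g M) (hz : proj f g M z = 0) :
    ∃ w, w - twist g M huv hf w = z := by
  let R : Submodule B (Restricted f g M) := LinearMap.range (LinearMap.id - twist g M huv hf)
  -- The `a` satisfying this for all `b`, `m` form a subring, so generators suffice.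
  have key (a : A) : ∀ b m, rtmul f g M b (a • m) - rtmul f g M (b * g a) m ∈ R := by
    have ha : a ∈ Subring.closure (Set.range f ∪ ({l | ∀ j, ∃ c, f c = u j * l} ∪
      {l | ∀ j, ∃ c, f c = l * v j})) := hA ▸ Subring.mem_top a
    induction ha using Subring.closure_induction with
    | mem l hl =>
      intro b m
      rcases hl with ⟨a, rfl⟩ | hl | hl
      · rw [rtmul_smul, sub_self]
        exact R.zero_mem
      · choose c hc using hl
        -- As `u_j l` comes from `A'`, `twist (b ⊗ l m) = ∑ b v_j u_j l ⊗ m = b l ⊗ m`.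
        refine ⟨rtmul f g M b (l • m), ?_⟩
        rw [LinearMap.sub_apply, LinearMap.id_apply, twist_rtmul]
        congr 1
        simp only [← mul_smul, ← hc, rtmul_smul]
        rw [← sum_rtmul]
        simp only [hc, mul_assoc, ← map_mul, ← Finset.mul_sum]
        simp only [← mul_assoc, ← map_sum, ← Finset.sum_mul, huv, one_mul]
      · choose c hc using hl
        -- As `l v_j` comes from `A'`, `twist (b l ⊗ m) = ∑ b ⊗ l v_j u_j m = b ⊗ l m`.
        refine ⟨-rtmul f g M (b * g l) m, ?_⟩
        rw [LinearMap.sub_apply, LinearMap.id_apply, map_neg, twist_rtmul, sub_neg_eq_add,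
          neg_add_eq_sub]
        congr 1
        simp only [mul_assoc, ← map_mul, ← hc, ← rtmul_smul]
        simp only [← rtmul_sum, hc, mul_smul, ← Finset.smul_sum]
        simp only [← mul_smul, ← Finset.sum_smul, huv, one_smul]
    | zero => intro b m; simp [zero_rtmul, rtmul_zero]
    | one => intro b m; simp
    | add x y _ _ hx hy =>
      intro b m
      rw [add_smul, rtmul_add, map_add, mul_add, add_rtmul, add_sub_add_comm]
      exact R.add_mem (hx b m) (hy b m)
    | neg x _ hx =>
      intro b m
      have := hx b (-m)
      rw [smul_neg, ← neg_smul] at this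
      have h : rtmul f g M (b * g x) (-m) = rtmul f g M (b * g (-x)) m := by
        rw [map_neg, mul_neg]
        exact (map_neg (rtmulHom f g M (b * g x)) m).trans
          (map_neg (rtmulHom' f g M m) (b * g x)).symm
      rwa [h] at this
    | mul x y _ _ hx hy =>
      intro b m
      have h1 := hx b (y • m)
      have h2 := hy (b * g x) m
      have := R.add_mem h1 h2
      rwa [sub_add_sub_cancel, ← mul_smul, mul_assoc, ← map_mul] at this
  -- Modulo the image of `1 - twist`, tensors are balanced over `A`; so `q` recovers `z` modulo that
  -- image from its projection.
  let q : BalancedTensor g M →ₗ[B] (Restricted f g M) ⧸ R :=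
    lift g (R.mkQ.toAddMonoidHom.comp (rtmulHom f g M 1)) fun a m => by
      change R.mkQ (rtmul f g M 1 (a • m)) = g a • R.mkQ (rtmul f g M 1 m)
      rw [← map_smul, smul_rtmul, mul_one, ← sub_eq_zero, ← map_sub, Submodule.mkQ_apply,
        Submodule.Quotient.mk_eq_zero]
      simpa using key a 1 m
  have hq (w) : q (proj f g M w) = R.mkQ w := by
    induction w using Restricted.induction_on with
    | h0 => simp
    | ha x y hx hy => rw [map_add, map_add, hx, hy, map_add]
    | ht b m =>
      rw [proj_rtmul, lift_tmul, rtmul_eq_smul, map_smul]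
      rfl
  have : R.mkQ z = 0 := by rw [← hq, hz, map_zero]
  rw [Submodule.mkQ_apply, Submodule.Quotient.mk_eq_zero] at this
  exact this

/-- If `M` is graded, then `1 - twist` is injective. -/
theorem eq_zero_of_twist_eq
    (p : ℤ → M →+ M) (hpf : ∀ k a m, p k (f a • m) = f a • p k m)
    (hp : ∀ k j m, p k (u j • m) = u j • p (k + 1) m)
    (hfin : ∀ m, ∃ S : Finset ℤ, (∀ k ∉ S, p k m = 0) ∧ ∑ k ∈ S, p k m = m)
    (z : Restricted f g M) (hz : twist g M huv hf z = z) : z = 0 := by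
  let P (k : ℤ) : Restricted f g M →ₗ[B] Restricted f g M :=
    rlift f g M ((rtmulHom f g M 1).comp (p k)) fun a m => by
      change rtmul f g M 1 (p k (f a • m)) = g (f a) • rtmul f g M 1 (p k m)
      rw [hpf, rtmul_smul, smul_rtmul, one_mul, mul_one]
  have hP (k : ℤ) (b : B) (m : M) : P k (rtmul f g M b m) = rtmul f g M b (p k m) := by
    rw [rlift_rtmul, rtmul_eq_smul f g M b]
    rfl
  have htw (k : ℤ) (w : Restricted f g M) :
      P k (twist g M huv hf w) = twist g M huv hf (P (k + 1) w) := by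
    induction w using Restricted.induction_on with
    | h0 => simp
    | ha x y hx hy => simp [hx, hy]
    | ht b m =>
      rw [hP, twist_rtmul, twist_rtmul, map_sum]
      refine Finset.sum_congr rfl fun j _ => ?_
      rw [hP, hp]
  have hS : ∃ S : Finset ℤ, (∀ k ∉ S, P k z = 0) ∧ ((∀ k, P k z = 0) → z = 0) := by
    -- Allowing all larger `S'` lets finite sets be united when tensors are added.
    suffices ∃ S : Finset ℤ, ∀ S', S ⊆ S' → (∀ k ∉ S', P k z = 0) ∧ ∑ k ∈ S', P k z = z by
      obtain ⟨S, hS⟩ := this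
      obtain ⟨h1, h2⟩ := hS S le_rfl
      exact ⟨S, h1, fun h => by rw [← h2]; exact Finset.sum_eq_zero fun k _ => h k⟩
    clear hz
    induction z using Restricted.induction_on with
    | h0 => exact ⟨∅, by simp⟩
    | ha x y hx hy =>
      obtain ⟨S, hS⟩ := hx
      obtain ⟨T, hT⟩ := hy
      refine ⟨S ∪ T, fun S' h => ?_⟩
      obtain ⟨h1, h2⟩ := hS S' (Finset.union_subset_left h)
      obtain ⟨h3, h4⟩ := hT S' (Finset.union_subset_right h)
      exact ⟨fun k hk => by rw [map_add, h1 k hk, h3 k hk, add_zero],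
        by simp only [map_add, Finset.sum_add_distrib, h2, h4]⟩
    | ht b m =>
      obtain ⟨S, h1, h2⟩ := hfin m
      refine ⟨S, fun S' h => ⟨fun k hk => ?_, ?_⟩⟩
      · rw [hP, h1 k fun hk' => hk (h hk')]
        exact rtmul_zero f g M b
      · simp only [hP]
        rw [← rtmul_sum]
        congr 1
        rw [← Finset.sum_subset h fun k _ hk => h1 k hk]
        exact h2
  obtain ⟨S, h1, h2⟩ := hS
  refine h2 fun k => ?_
  -- A fixed `z` satisfies `P k z = twist (P (k + 1) z)`, so vanishing in high degrees descends to
  -- all degrees.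
  have h3 (n : ℕ) : ∀ k, P (k + n) z = 0 → P k z = 0 := by
    induction n with
    | zero => intro k hk; simpa using hk
    | succ n ih =>
      intro k hk
      have := ih (k + 1) (by rw [add_assoc, add_comm 1]; exact_mod_cast hk)
      rw [← hz, htw, this, map_zero]
  obtain ⟨N, hN⟩ := S.bddAbove
  refine h3 (N - k + 1).toNat k (h1 _ fun h => ?_)
  have := hN h
  omega

end BalancedTensor

/-! ### Acyclicity transferred along a homotopy retraction -/

namespace ModuleComplex

variable {A : Type u} [Ring A]

/-- Suppose `0 → X → X → Y → 0` is exact with first map `1 - T`, and `X` is a homotopy retract of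
`D` via `i` and `r`. If `1 - iTr` is bijective, then `Y` has vanishing homology. -/
theorem hasTrivialHomology_of_bijective {X D Y : ChainComplex (ModuleCat.{u} A) ℤ}
    (i : X ⟶ D) (r : D ⟶ X) (H : Homotopy (i ≫ r) (𝟙 X)) (T : X ⟶ X) (π : X ⟶ Y)
    (hsurj : ∀ n, Function.Surjective (π.f n).hom)
    (hπT : ∀ n z, (π.f n).hom ((T.f n).hom z) = (π.f n).hom z)
    (hker : ∀ n z, (π.f n).hom z = 0 → ∃ w, w - (T.f n).hom w = z)
    (hinj : ∀ n z, (T.f n).hom z = z → z = 0)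
    (hD : ∀ n, Function.Bijective
      fun z : D.X n => z - (i.f n).hom ((T.f n).hom ((r.f n).hom z))) :
    HasTrivialHomology Y := by
  rw [hasTrivialHomology_iff]
  intro n z hz
  obtain ⟨m, rfl⟩ : ∃ m, n = m + 1 := ⟨n - 1, by ring⟩
  have hri (k : ℤ) (x : X.X (k + 1)) : (r.f (k + 1)).hom ((i.f (k + 1)).hom x) =
      (H.hom k (k + 1)).hom ((X.d (k + 1) k).hom x) +
      (X.d (k + 1 + 1) (k + 1)).hom ((H.hom (k + 1) (k + 1 + 1)).hom x) + x :=
    homotopy_apply H k x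
  have hD0 (n) (z : D.X n) (h : z - (i.f n).hom ((T.f n).hom ((r.f n).hom z)) = 0) : z = 0 :=
    (hD n).1 (by simpa using h)
  obtain ⟨z', rfl⟩ := hsurj _ z
  rw [← map_d] at hz
  obtain ⟨y, hy⟩ := hker _ _ hz
  have hdy : (X.d (m + 1) m).hom y = 0 := by
    refine hinj _ _ (sub_eq_zero.1 ?_).symm
    rw [map_d, ← map_sub, hy, d_d]
  have hy2 := hri m y
  rw [hdy, map_zero, zero_add] at hy2
  -- With this choice `d v'` and `i y` have the same image under the injective map `1 - i T r`.
  obtain ⟨v', hv'⟩ := (hD (m + 1 + 1)).2 ((i.f _).hom z' -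
    (i.f _).hom ((T.f _).hom ((H.hom (m + 1) (m + 1 + 1)).hom y)))
  have hiy : (i.f _).hom y = (D.d (m + 1 + 1) (m + 1)).hom v' := by
    refine sub_eq_zero.1 (hD0 _ _ ?_)
    have := congrArg (D.d (m + 1 + 1) (m + 1)).hom hv'
    simp only [map_sub, ← map_d] at this ⊢
    rw [hy2]
    rw [← hy, map_sub, ← sub_eq_zero] at this
    rw [← neg_eq_zero, ← this]
    simp only [map_add]
    abel
  obtain ⟨y', rfl⟩ : ∃ y', (X.d (m + 1 + 1) (m + 1)).hom y' = y :=
    ⟨(r.f _).hom v' - (H.hom (m + 1) (m + 1 + 1)).hom y, by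
      rw [map_sub, ← map_d, ← hiy, hy2, add_sub_cancel_left]⟩
  -- Subtracting `(1 - T) y'` turns `z'` into a cycle with the same image in `Y`.
  obtain ⟨w, hw, hdw⟩ : ∃ w, (π.f _).hom w = (π.f _).hom z' ∧
      (X.d (m + 1 + 1) (m + 1)).hom w = 0 := by
    refine ⟨z' - (y' - (T.f _).hom y'), ?_, ?_⟩
    · rw [map_sub, map_sub, hπT, sub_self, sub_zero]
    · rw [map_sub, map_sub, ← map_d, hy, sub_self]
  rw [← hw]
  -- Applying `r` to `(1 - i T r) v = i w` gives `(1 - T) r v = w + d (h w + h T r v)`, and `π`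
  -- kills the left side.
  obtain ⟨v, hv⟩ := (hD (m + 1 + 1)).2 ((i.f _).hom w)
  have hdv : (D.d (m + 1 + 1) (m + 1)).hom v = 0 := by
    refine hD0 _ _ ?_
    have := congrArg (D.d (m + 1 + 1) (m + 1)).hom hv
    simpa only [map_sub, ← map_d, hdw, map_zero] using this
  refine ⟨(π.f _).hom (-((H.hom (m + 1 + 1) (m + 1 + 1 + 1)).hom ((T.f _).hom ((r.f _).hom v)) +
    (H.hom (m + 1 + 1) (m + 1 + 1 + 1)).hom w)), ?_⟩
  have h1 := hri (m + 1) w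
  rw [← hv, map_sub, hri, ← map_d, ← map_d, hdv, hdw] at h1
  simp only [map_zero, zero_add] at h1
  have h2 := congrArg (π.f _).hom h1
  simp only [map_sub, map_add, hπT, map_neg, map_d] at h2 ⊢
  rw [← sub_eq_zero] at h2 ⊢
  rw [← h2]
  abel

end ModuleComplex

/-! ### Geometric series over the Novikov ring -/

namespace Novikov

open MulOpposite

variable {L : Type u} [Ring L] (𝒜 : ℤ → AddSubgroup L) [GradedRing 𝒜]

theorem incl_of_mem {k : ℤ} {x : L} (hx : x ∈ 𝒜 k) :
    (incl 𝒜 x).1 = HahnSeries.single k x := by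
  ext n
  rw [coeff_incl]
  by_cases h : n = k
  · subst h
    rw [DirectSum.decompose_of_mem_same 𝒜 hx, HahnSeries.coeff_single_same]
  · rw [DirectSum.decompose_of_mem_ne 𝒜 hx (Ne.symm h), HahnSeries.coeff_single_of_ne h]

/-- A matrix with entries of degree one over the Novikov ring is topologically nilpotent, so
subtracting it from the identity matrix gives an invertible matrix. -/
theorem bijective_sub_of_degree_one {ι : Type*} [Fintype ι] [DecidableEq ι]
    (V : (ι → (Novikov 𝒜)ᵐᵒᵖ) →ₗ[(Novikov 𝒜)ᵐᵒᵖ] (ι → (Novikov 𝒜)ᵐᵒᵖ)) (c : ι → ι → L)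
    (hc : ∀ a b, c a b ∈ 𝒜 1) (hV : ∀ a b, V (Pi.single a 1) b = op (incl 𝒜 (c a b))) :
    Function.Bijective fun z => z - V z := by
  let co (z : ι → (Novikov 𝒜)ᵐᵒᵖ) (b : ι) (k : ℤ) : L := (unop (z b)).1.coeff k
  have hco (z b k) : co (V z) b (k + 1) = ∑ a, c a b * co z a k := by
    have h1 : V z b = ∑ a, z a * op (incl 𝒜 (c a b)) := by
      conv_lhs => rw [← Finset.univ_sum_single z, map_sum, Finset.sum_apply]
      refine Finset.sum_congr rfl fun a _ => ?_
      have : Pi.single a (z a) = z a • (Pi.single a 1 : ι → (Novikov 𝒜)ᵐᵒᵖ) := by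
        rw [← Pi.single_smul, smul_eq_mul, mul_one]
      rw [this, map_smul, Pi.smul_apply, hV, smul_eq_mul]
    simp only [co]
    rw [h1, Finset.unop_sum]
    simp only [unop_mul, unop_op, AddSubmonoidClass.coe_finsetSum, HahnSeries.coeff_sum,
      Subring.coe_mul, incl_of_mem 𝒜 (hc _ _), HahnSeries.coeff_single_mul_add]
  have hext (z w) (h : ∀ b k, co z b k = co w b k) : z = w := by
    ext b : 1
    exact unop_injective (Subtype.ext (HahnSeries.ext (funext (h b))))
  have hbdd (z) : ∃ N, ∀ b k, k < N → co z b k = 0 := by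
    obtain ⟨N, hN⟩ := (Set.finite_range fun b => (unop (z b)).1.order).bddBelow
    exact ⟨N, fun b k hk => HahnSeries.coeff_eq_zero_of_lt_order
      (hk.trans_le (hN ⟨b, rfl⟩))⟩
  have hcosub (z w b k) : co (z - w) b k = co z b k - co w b k := rfl
  constructor
  · intro z w hzw
    rw [← sub_eq_zero]
    have h0 : z - w = V (z - w) := by
      replace hzw : z - V z = w - V w := hzw
      rw [map_sub, ← sub_eq_zero, ← sub_eq_zero.2 hzw]
      abel
    generalize z - w = x at h0
    obtain ⟨N, hN⟩ := hbdd x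
    -- Each coefficient of `x = V x` is determined by those one degree lower, so vanishing below `N`
    -- spreads upwards.
    have (n : ℕ) : ∀ b k, k < N + n → co x b k = 0 := by
      induction n with
      | zero => simpa using hN
      | succ n ih =>
        intro b k hk
        obtain ⟨l, rfl⟩ : ∃ l, k = l + 1 := ⟨k - 1, by ring⟩
        rw [h0, hco]
        refine Finset.sum_eq_zero fun a _ => ?_
        rw [ih a l (by push_cast at hk; omega), mul_zero]
    exact hext _ _ fun b k => this (k - N + 1).toNat b k (by omega)
  · intro w
    obtain ⟨N, hN⟩ := hbdd w
    -- The equation `v = w + V v` is solved degree by degree; `e n` is the coefficient in degree `N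
    -- + n`.
    let e (n : ℕ) : ι → L := Nat.rec (fun b => co w b N)
      (fun n e b => co w b (N + (n + 1)) + ∑ a, c a b * e a) n
    have he (n : ℕ) : ∀ b, e n b ∈ 𝒜 (N + n) := by
      induction n with
      | zero =>
        intro b
        rw [Nat.cast_zero, add_zero]
        exact (unop (w b)).2 N
      | succ n ih =>
        intro b
        refine (𝒜 _).add_mem ((unop (w b)).2 _) ((𝒜 _).sum_mem fun a _ => ?_)
        have := SetLike.GradedMul.mul_mem (hc a b) (ih a)
        convert this using 2
        push_cast; ring
    let v' (b : ι) (k : ℤ) : L := if k < N then 0 else e (k - N).toNat b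
    have hv' (b) : ∃ x : Novikov 𝒜, x.1.coeff = v' b := by
      rw [exists_iff]
      refine ⟨fun k => ?_, N, fun k hk => if_pos hk⟩
      simp only [v']
      split_ifs with h
      · exact (𝒜 k).zero_mem
      · convert he (k - N).toNat b using 2
        omega
    choose v hv using hv'
    refine ⟨fun b => op (v b), hext _ _ fun b k => ?_⟩
    have hcov (b k) : co (fun b => op (v b)) b k = v' b k := congrFun (hv b) k
    obtain ⟨l, rfl⟩ : ∃ l, k = l + 1 := ⟨k - 1, by ring⟩
    rw [hcosub, hco]
    simp only [hcov]
    by_cases h1 : l + 1 < N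
    · have hl (a) : v' a l = 0 := if_pos (by omega)
      simp only [hl, mul_zero, Finset.sum_const_zero, sub_zero]
      rw [hN b _ h1]
      exact if_pos h1
    by_cases h2 : l + 1 = N
    · have hl (a) : v' a l = 0 := if_pos (by omega)
      simp only [hl, mul_zero, Finset.sum_const_zero, sub_zero, h2, v']
      simp [e]
    · obtain ⟨n, rfl⟩ : ∃ n : ℕ, l = N + n := ⟨(l - N).toNat, by omega⟩
      have h3 (a) : v' a (N + n) = e n a := by simp [v']
      have h4 : v' b (N + n + 1) = e (n + 1) b := by
        simp only [v']
        rw [if_neg h1, show (N + n + 1 - N).toNat = n + 1 by omega]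
      rw [h4]
      simp only [h3]
      change co w b (N + (n + 1)) + _ - _ = _
      rw [add_sub_cancel_right, add_assoc]

end Novikov

/-! ### Strongly graded rings: partitions of unity, generation -/

section StronglyGraded

open MulOpposite

variable {L : Type u} [Ring L] {𝒜 : ℤ → AddSubgroup L}

theorem IsStronglyGraded.neg (h : IsStronglyGraded 𝒜) :
    IsStronglyGraded (negGrading 𝒜) := by
  intro k l
  change AddSubgroup.closure {z : L | ∃ x ∈ 𝒜 (-k), ∃ y ∈ 𝒜 (-l), z = x * y} = 𝒜 (-(k + l))
  rw [h, neg_add]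

/-- Here `1 ∈ L_0 = L_{-k} L_k`. Such partitions of unity replace `t^{-k} t^k = 1`. -/
theorem IsStronglyGraded.exists_sum_eq_one [GradedRing 𝒜] (h : IsStronglyGraded 𝒜) (k : ℤ) :
    ∃ (n : ℕ) (x y : Fin n → L), (∀ j, x j ∈ 𝒜 (-k)) ∧ (∀ j, y j ∈ 𝒜 k) ∧
      ∑ j, x j * y j = 1 := by
  have h1 : (1 : L) ∈ AddSubgroup.closure {z : L | ∃ x ∈ 𝒜 (-k), ∃ y ∈ 𝒜 k, z = x * y} := by
    rw [h, neg_add_cancel]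
    exact SetLike.GradedOne.one_mem
  generalize (1 : L) = z at h1 ⊢
  induction h1 using AddSubgroup.closure_induction with
  | mem z hz =>
    obtain ⟨x, hx, y, hy, rfl⟩ := hz
    exact ⟨1, fun _ => x, fun _ => y, fun _ => hx, fun _ => hy, by simp⟩
  | zero => exact ⟨0, Fin.elim0, Fin.elim0, fun j => j.elim0, fun j => j.elim0, by simp⟩
  | add a b _ _ ha hb =>
    obtain ⟨n, x, y, hx, hy, rfl⟩ := ha
    obtain ⟨m, x', y', hx', hy', rfl⟩ := hb
    refine ⟨n + m, Fin.append x x', Fin.append y y', fun j => ?_, fun j => ?_, ?_⟩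
    · refine Fin.addCases (fun i => ?_) (fun i => ?_) j <;> simp [hx, hx']
    · refine Fin.addCases (fun i => ?_) (fun i => ?_) j <;> simp [hy, hy']
    · simp [Fin.sum_univ_add]
  | neg a _ ha =>
    obtain ⟨n, x, y, hx, hy, rfl⟩ := ha
    exact ⟨n, fun j => -x j, y, fun j => neg_mem (hx j), hy, by simp⟩

/-- A strongly graded ring is generated by its elements of degrees `0`, `1` and `-1`. -/
theorem IsStronglyGraded.closure_eq_top [GradedRing 𝒜] (h : IsStronglyGraded 𝒜) (S : Subring L)
    (h0 : ∀ x ∈ 𝒜 0, x ∈ S) (h1 : ∀ x ∈ 𝒜 1, x ∈ S) (h2 : ∀ x ∈ 𝒜 (-1), x ∈ S) : S = ⊤ := by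
  have key (ε : ℤ) (hε : ∀ x ∈ 𝒜 ε, x ∈ S) (n : ℕ) : ∀ x ∈ 𝒜 (n * ε), x ∈ S := by
    induction n with
    | zero => simpa using h0
    | succ n ih =>
      intro x hx
      rw [show ((n + 1 : ℕ) : ℤ) * ε = n * ε + ε by push_cast; ring, ← h] at hx
      refine (AddSubgroup.closure_le S.toAddSubgroup).2 ?_ hx
      rintro _ ⟨x, hx, y, hy, rfl⟩
      exact S.mul_mem (ih x hx) (hε y hy)
  refine eq_top_iff.2 fun x _ => ?_
  induction x using DirectSum.Decomposition.inductionOn 𝒜 with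
  | zero => exact S.zero_mem
  | add x y hx hy => exact S.add_mem (hx trivial) (hy trivial)
  | @homogeneous i x =>
    rcases le_total 0 i with hi | hi
    · exact key 1 h1 i.toNat x (by convert x.2 using 2; omega)
    · exact key (-1) h2 (-i).toNat x (by convert x.2 using 2; omega)

theorem MulOpposite.closure_eq_top_of_unop {S : Set Lᵐᵒᵖ}
    (h : Subring.closure (op ⁻¹' S) = ⊤) : Subring.closure S = ⊤ := by
  have : (⊤ : Subring L) ≤ (Subring.closure S).unop := by
    rw [← h, Subring.closure_le]
    intro x hx
    exact Subring.subset_closure hx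
  exact eq_top_iff.2 fun x _ => this (x := unop x) trivial

end StronglyGraded

/-! ### Homogeneous components in a based free module -/

section Components

open MulOpposite

variable {L : Type u} [Ring L] (𝒜 : ℤ → AddSubgroup L) [GradedRing 𝒜]
variable {M : Type u} [AddCommGroup M] [Module Lᵐᵒᵖ M] {ι : Type*}
  [Fintype ι] (b : Module.Basis ι Lᵐᵒᵖ M)

theorem decompose_mul_of_right_mem {x y : L} {l : ℤ} (hy : y ∈ 𝒜 l) (k : ℤ) :
    (DirectSum.decompose 𝒜 (x * y) (k + l) : L) = DirectSum.decompose 𝒜 x k * y :=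
  DirectSum.coe_decompose_mul_add_of_right_mem 𝒜 hy

/-- The homogeneous components of the elements of a free module with a basis in degree `0`. -/
noncomputable def gradedComponent (k : ℤ) : M →+ M where
  toFun m := ∑ i, op (DirectSum.decompose 𝒜 (unop (b.repr m i)) k : L) • b i
  map_zero' := by simp
  map_add' m m' := by simp [add_smul, Finset.sum_add_distrib]

theorem gradedComponent_apply (k : ℤ) (m : M) : gradedComponent 𝒜 b k m =
    ∑ i, op (DirectSum.decompose 𝒜 (unop (b.repr m i)) k : L) • b i := rfl

theorem gradedComponent_smul {l : ℤ} {x : L} (hx : x ∈ 𝒜 l) (k : ℤ) (m : M) :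
    gradedComponent 𝒜 b (k + l) (op x • m) = op x • gradedComponent 𝒜 b k m := by
  simp only [gradedComponent_apply, map_smul, Finsupp.smul_apply, smul_eq_mul, unop_mul, unop_op,
    decompose_mul_of_right_mem 𝒜 hx, Finset.smul_sum, ← mul_smul, ← op_mul]

theorem exists_finset_gradedComponent (m : M) :
    ∃ S : Finset ℤ, (∀ k ∉ S, gradedComponent 𝒜 b k m = 0) ∧
      ∑ k ∈ S, gradedComponent 𝒜 b k m = m := by
  classical
  let S := Finset.univ.biUnion fun i => (DirectSum.decompose 𝒜 (unop (b.repr m i))).support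
  have hS (k) (hk : k ∉ S) (i) : (DirectSum.decompose 𝒜 (unop (b.repr m i)) k : L) = 0 := by
    by_contra h
    exact hk (Finset.mem_biUnion.2 ⟨i, Finset.mem_univ _, by simpa using h⟩)
  refine ⟨S, fun k hk => ?_, ?_⟩
  · rw [gradedComponent_apply]
    exact Finset.sum_eq_zero fun i _ => by rw [hS k hk, op_zero, zero_smul]
  · simp only [gradedComponent_apply]
    rw [Finset.sum_comm]
    conv_rhs => rw [← b.sum_repr m]
    refine Finset.sum_congr rfl fun i _ => ?_
    rw [← Finset.sum_smul, ← Finset.op_sum]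
    congr 1
    refine unop_injective ?_
    rw [unop_op]
    conv_rhs => rw [← DirectSum.sum_support_decompose 𝒜 (unop (b.repr m i))]
    refine (Finset.sum_subset (Finset.subset_biUnion_of_mem
      (fun i => (DirectSum.decompose 𝒜 (unop (b.repr m i))).support) (Finset.mem_univ i))
      fun k _ hk => ?_).symm
    simpa using hk

end Components

/-! ### Finite domination implies acyclic completions -/

section FinitelyDominated

open MulOpposite BalancedTensor

variable {L : Type u} [Ring L] {𝒜 : ℤ → AddSubgroup L} [GradedRing 𝒜]

/-- If `C` is finitely dominated over the degree zero subring, then `C ⊗_L R((t))` is acyclic. -/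
theorem IsFinitelyDominated.hasTrivialHomology (h𝒜 : IsStronglyGraded 𝒜) {K : Subring L}
    (hK : ∀ x, x ∈ K ↔ x ∈ 𝒜 0) {C : ChainComplex (ModuleCat.{u} Lᵐᵒᵖ) ℤ}
    (hC : IsBoundedFGFree C) (hfd : IsFinitelyDominated K C) :
    HasTrivialHomology (tensorComplex (Novikov.incl 𝒜) C) := by
  obtain ⟨D, hD, i, r, ⟨H⟩⟩ := hfd
  obtain ⟨N, x, y, hx, hy, hxy⟩ := h𝒜.exists_sum_eq_one 1
  let f : Kᵐᵒᵖ →+* Lᵐᵒᵖ := K.subtype.op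
  let g : Lᵐᵒᵖ →+* (Novikov 𝒜)ᵐᵒᵖ := (Novikov.incl 𝒜).op
  -- With `x_j` of degree `-1` and `y_j` of degree `1`, the twist moves degree one onto the Novikov
  -- factor.
  let u (j : Fin N) : Lᵐᵒᵖ := op (x j)
  let v (j : Fin N) : Lᵐᵒᵖ := op (y j)
  have huv : ∑ j, v j * u j = 1 := by
    simp only [u, v, ← op_mul, ← Finset.op_sum, hxy, op_one]
  have hmem {l : L} (hl : l ∈ 𝒜 0) : ∃ c, f c = op l := ⟨op ⟨l, (hK l).2 hl⟩, rfl⟩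
  have hf (i j a) : ∃ c, f c = u i * f a * v j := by
    have h1 := SetLike.GradedMul.mul_mem (hy j) (SetLike.GradedMul.mul_mem
      ((hK _).1 (unop a).2) (hx i))
    simp only [zero_add, add_neg_cancel] at h1
    exact hmem h1
  let F := (extendScalarsNC (g.comp f)).mapHomologicalComplex (ComplexShape.down ℤ)
  let T : F.obj (restrictComplex K C) ⟶ F.obj (restrictComplex K C) :=
    { f := fun n => ModuleCat.ofHom (twist g (C.X n) huv hf)
      comm' := fun i j _ => by
        refine ModuleCat.hom_ext (LinearMap.ext fun (z : Restricted f g (C.X i)) => ?_)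
        exact twist_comm g huv hf (C.d i j).hom ((F.obj (restrictComplex K C)).d i j).hom
          (fun _ _ => rfl) z }
  let π : F.obj (restrictComplex K C) ⟶ tensorComplex (Novikov.incl 𝒜) C :=
    { f := fun n => ModuleCat.ofHom (proj f g (C.X n))
      comm' := fun i j _ => by
        refine ModuleCat.hom_ext (LinearMap.ext fun (z : Restricted f g (C.X i)) => ?_)
        exact proj_comm (C.d i j).hom ((F.obj (restrictComplex K C)).d i j).hom
          (fun _ _ => rfl) z }
  have H' : Homotopy (F.map i ≫ F.map r) (𝟙 _) :=
    (Homotopy.ofEq (F.map_comp i r).symm).trans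
      (((extendScalarsNC (g.comp f)).mapHomotopy H).trans (Homotopy.ofEq (F.map_id _)))
  have hfree (n) := (hC.2 n).2
  have hfin (n) := (hC.2 n).1
  refine ModuleComplex.hasTrivialHomology_of_bijective (F.map i) (F.map r) H' T π
    (fun n => proj_surjective f g (C.X n)) (fun n z => proj_twist g (C.X n) huv hf z)
    (fun n z hz => exists_of_proj_eq_zero g (C.X n) huv hf ?_ z hz)
    (fun n z hz => ?_) (fun n => ?_)
  · refine MulOpposite.closure_eq_top_of_unop (h𝒜.closure_eq_top _ (fun a ha => ?_)
      (fun a ha => ?_) fun a ha => ?_) <;> refine Subring.subset_closure ?_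
    · exact Or.inl (hmem ha)
    · refine Or.inr (Or.inl fun j => hmem (l := a * x j) ?_)
      simpa using SetLike.GradedMul.mul_mem ha (hx j)
    · refine Or.inr (Or.inr fun j => hmem (l := y j * a) ?_)
      simpa using SetLike.GradedMul.mul_mem (hy j) ha
  · let b := Module.Free.chooseBasis Lᵐᵒᵖ (C.X n)
    refine eq_zero_of_twist_eq g (C.X n) huv hf (gradedComponent 𝒜 b) (fun k a m => ?_)
      (fun k j m => ?_) (exists_finset_gradedComponent 𝒜 b) z hz
    · have := gradedComponent_smul 𝒜 b ((hK _).1 (unop a).2) k m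
      rwa [add_zero] at this
    · have := gradedComponent_smul 𝒜 b (hx j) (k + 1) m
      rwa [add_neg_cancel_right] at this
  · obtain ⟨_, _⟩ := hD.2 n
    classical
    let e := Module.Free.chooseBasis Kᵐᵒᵖ (D.X n)
    let φ := coord (g.comp f) e
    let U : BalancedTensor (g.comp f) (D.X n) →ₗ[(Novikov 𝒜)ᵐᵒᵖ]
        BalancedTensor (g.comp f) (D.X n) := ((F.map i).f n).hom ∘ₗ twist g (C.X n) huv hf ∘ₗ ((F.map r).f n).hom
    let rn (m : D.X n) : C.X n := (r.f n).hom m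
    let j' (m : C.X n) : D.X n := (i.f n).hom m
    -- Matrix of `i T r`: the coordinates of `i (u_j r (e_a))` have degree `0`, and `y_j` has degree
    -- `1`.
    let c (a b) : L := ∑ j, ((unop (e.repr (j' (u j • rn (e a))) b) : K) : L) * y j
    have hc (a b) : c a b ∈ 𝒜 1 := (𝒜 1).sum_mem fun j _ => by
      simpa using SetLike.GradedMul.mul_mem ((hK _).1
        (unop (e.repr (j' (u j • rn (e a))) b)).2) (hy j)
    have hU (m : D.X n) : U (tmul (g.comp f) 1 m) =
        ∑ j, tmul (g.comp f) (g (v j)) (j' (u j • rn m)) := by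
      have h1 : twist g (C.X n) huv hf (rtmul f g (C.X n) 1 (rn m)) =
        ∑ j, rtmul f g (C.X n) (g (v j)) (u j • rn m) := by
        rw [twist_rtmul]
        simp only [one_mul]
      exact (congrArg ((F.map i).f n).hom h1).trans (map_sum ((F.map i).f n).hom _ _)
    have := Novikov.bijective_sub_of_degree_one 𝒜 (φ.toLinearMap ∘ₗ U ∘ₗ φ.symm.toLinearMap) c hc
      fun a b => by
        have h1 : φ.symm (Pi.single a 1) = tmul (g.comp f) 1 (e a) := by
          rw [LinearEquiv.symm_apply_eq]
          ext k
          rw [coord_tmul, Module.Basis.repr_self, Finsupp.single_apply, Pi.single_apply]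
          by_cases h : a = k <;> simp [h, eq_comm]
        change φ (U (φ.symm (Pi.single a 1))) b = _
        rw [h1, hU, map_sum, Finset.sum_apply, map_sum, Finset.op_sum]
        refine Finset.sum_congr rfl fun j _ => ?_
        rw [coord_tmul, map_mul, op_mul]
        rfl
    have h2 : (fun z => z - U z) = φ.symm ∘
        (fun z => z - (φ.toLinearMap ∘ₗ U ∘ₗ φ.symm.toLinearMap) z) ∘ φ := by
      funext z
      change z - U z = φ.symm (φ z - φ (U (φ.symm (φ z))))
      rw [← map_sub, φ.symm_apply_apply, φ.symm_apply_apply]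
    exact h2 ▸ φ.symm.bijective.comp (this.comp φ.bijective)

end FinitelyDominated

/-! ### Projectivity over the degree zero subring -/

section Projective

open MulOpposite

variable {L : Type u} [Ring L] {𝒜 : ℤ → AddSubgroup L} [GradedRing 𝒜]

/-- A finitely generated free module over a strongly graded ring is projective over the subring
of degree zero. -/
theorem IsStronglyGraded.projective (h𝒜 : IsStronglyGraded 𝒜) {K : Subring L}
    (hK : ∀ x, x ∈ K ↔ x ∈ 𝒜 0) {M : Type u} [AddCommGroup M] [Module Lᵐᵒᵖ M] {ι : Type*}
    [Fintype ι] (b : Module.Basis ι Lᵐᵒᵖ M) [Module Kᵐᵒᵖ M]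
    (hM : ∀ (c : K) (m : M), op c • m = op (c : L) • m) : Module.Projective Kᵐᵒᵖ M := by
  -- Here `x k j ∈ L_k` and `y k j ∈ L_{-k}`, so `l = ∑ x_j (y_j l)` with `y_j l ∈ K` is a dual
  -- basis of `L_k` over `K`. A section of `q` is then fixed by lifting the elements `x_j b_i`.
  choose N x y hx hy hxy using fun k => h𝒜.exists_sum_eq_one (-k)
  refine Module.Projective.of_lifting_property'' fun q hq => ?_
  choose t ht using hq
  have hyK (k j) (l : 𝒜 k) : y k j * l ∈ K := by
    rw [hK]
    simpa using SetLike.GradedMul.mul_mem (hy k j) l.2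
  let φ (i : ι) (k : ℤ) : 𝒜 k →+ (M →₀ Kᵐᵒᵖ) := AddMonoidHom.mk'
    (fun l => ∑ j, (op ⟨y k j * l, hyK k j l⟩ : Kᵐᵒᵖ) • t (op (x k j) • b i)) fun l l' => by
      rw [← Finset.sum_add_distrib]
      refine Finset.sum_congr rfl fun j _ => ?_
      rw [← add_smul, ← MulOpposite.op_add]
      congr 2
      exact Subtype.ext (mul_add _ _ _)
  have hφ (i k) (l : 𝒜 k) :
      φ i k l = ∑ j, (op ⟨y k j * l, hyK k j l⟩ : Kᵐᵒᵖ) • t (op (x k j) • b i) := rfl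
  let G (i : ι) : L →+ (M →₀ Kᵐᵒᵖ) :=
    (DirectSum.toAddMonoid (φ i)).comp (DirectSum.decomposeAddEquiv 𝒜).toAddMonoidHom
  have hG (i k) (l : L) (hl : l ∈ 𝒜 k) : G i l = φ i k ⟨l, hl⟩ := by
    change DirectSum.toAddMonoid (φ i) (DirectSum.decompose 𝒜 l) = _
    rw [DirectSum.decompose_of_mem 𝒜 hl, DirectSum.toAddMonoid_of]
  have hGs (i) (l : L) (c : K) : G i (l * c) = op c • G i l := by
    induction l using DirectSum.Decomposition.inductionOn 𝒜 with
    | zero => simp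
    | add l l' h h' => rw [add_mul, map_add, map_add, smul_add, h, h']
    | @homogeneous k l =>
      have hlc : (l : L) * c ∈ 𝒜 k := by
        simpa using SetLike.GradedMul.mul_mem l.2 ((hK _).1 c.2)
      rw [hG i k _ hlc, hG i k _ l.2, hφ, hφ, Finset.smul_sum]
      refine Finset.sum_congr rfl fun j _ => ?_
      rw [← mul_smul, ← op_mul]
      congr 2
      exact Subtype.ext (mul_assoc _ _ _).symm
  have hqG (i) (l : L) : q (G i l) = op l • b i := by
    induction l using DirectSum.Decomposition.inductionOn 𝒜 with
    | zero => simp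
    | add l l' h h' => rw [map_add, map_add, h, h', MulOpposite.op_add, add_smul]
    | @homogeneous k l =>
      rw [hG i k _ l.2, hφ, map_sum]
      calc _ = ∑ j, op (x k j * y k j * (l : L)) • b i := by
            refine Finset.sum_congr rfl fun j _ => ?_
            rw [map_smul, ht, hM, ← mul_smul, ← op_mul, mul_assoc]
        _ = _ := by rw [← Finset.sum_smul, ← Finset.op_sum, ← Finset.sum_mul, hxy, one_mul]
  refine ⟨{ toFun := fun m => ∑ i, G i (unop (b.repr m i))
            map_add' := fun m m' => by simp [Finset.sum_add_distrib]
            map_smul' := fun c m => ?_ }, LinearMap.ext fun m => ?_⟩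
  · induction c using MulOpposite.rec' with | _ c => ?_
    rw [hM, RingHom.id_apply, Finset.smul_sum]
    refine Finset.sum_congr rfl fun i _ => ?_
    rw [map_smul, Finsupp.smul_apply, smul_eq_mul, unop_mul, unop_op, hGs]
  · change q (∑ i, G i (unop (b.repr m i))) = m
    simp only [map_sum, hqG, op_unop]
    exact b.sum_repr m

end Projective

/-! ### Degree filtrations and finite generation of bands -/

section Filtration

open MulOpposite

variable {L : Type u} [Ring L] (𝒜 : ℤ → AddSubgroup L) [GradedRing 𝒜]
variable {M : Type u} [AddCommGroup M] [Module Lᵐᵒᵖ M] {ι : Type*}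
  (b : Module.Basis ι Lᵐᵒᵖ M)

/-- The elements of a free module whose coordinates have no components of degree less than `p`. -/
def gradedFiltration (p : ℤ) : AddSubgroup M where
  carrier := {m | ∀ i k, k < p → (DirectSum.decompose 𝒜 (unop (b.repr m i)) k : L) = 0}
  zero_mem' := by simp
  add_mem' {m m'} h h' i k hk := by simp [h i k hk, h' i k hk]
  neg_mem' {m} h i k hk := by
    rw [map_neg, Finsupp.neg_apply, MulOpposite.unop_neg, DirectSum.decompose_neg]
    exact (congrArg Neg.neg (h i k hk)).trans neg_zero

theorem mem_gradedFiltration {p : ℤ} {m : M} : m ∈ gradedFiltration 𝒜 b p ↔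
    ∀ i k, k < p → (DirectSum.decompose 𝒜 (unop (b.repr m i)) k : L) = 0 := Iff.rfl

theorem gradedFiltration_negGrading_negGrading (p : ℤ) :
    gradedFiltration (negGrading (negGrading 𝒜)) b p = gradedFiltration 𝒜 b p := by
  have h (x k) : (DirectSum.decompose 𝒜 x (- -k) : L) = DirectSum.decompose 𝒜 x k := by
    rw [neg_neg]
  ext m
  simp only [mem_gradedFiltration, negGrading_decompose, h]

theorem smul_mem_gradedFiltration {p : ℤ} {m : M} (hm : m ∈ gradedFiltration 𝒜 b p) {x : L}
    (hx : x ∈ 𝒜 0) : op x • m ∈ gradedFiltration 𝒜 b p := by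
  intro i k hk
  have := decompose_mul_of_right_mem 𝒜 (x := unop (b.repr m i)) hx k
  rw [add_zero, hm i k hk, zero_mul] at this
  simpa using this

/-- The elements of `M` whose components have bounded degrees form a finitely generated module
over the subring of degree zero. -/
theorem IsStronglyGraded.fg_of_mem_gradedFiltration {𝒜 : ℤ → AddSubgroup L} [GradedRing 𝒜] [Finite ι]
    (h𝒜 : IsStronglyGraded 𝒜) {K : Subring L} (hK : ∀ x, x ∈ K ↔ x ∈ 𝒜 0) [Module Kᵐᵒᵖ M]
    (hM : ∀ (c : K) (m : M), op c • m = op (c : L) • m) (p : ℤ) (W : Submodule Kᵐᵒᵖ M)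
    (hW : ∀ m, m ∈ W ↔ m ∈ gradedFiltration 𝒜 b p ∧ m ∈ gradedFiltration (negGrading 𝒜) b p) :
    W.FG := by
  classical
  have := Fintype.ofFinite ι
  choose N x y hx hy hxy using fun k => h𝒜.exists_sum_eq_one (-k)
  -- Both filtrations together confine degrees to `[p, -p]`, and the `x k j` generate `L_k` over
  -- `K`.
  let S : Finset M := Finset.univ.biUnion fun i : ι => (Finset.Icc p (-p)).biUnion fun k =>
    Finset.univ.image fun j : Fin (N k) => op (x k j) • b i
  refine ⟨S, le_antisymm (Submodule.span_le.2 fun m hm => ?_) fun m hm => ?_⟩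
  · simp only [S, Finset.coe_biUnion, Set.mem_iUnion, Finset.coe_image, Set.mem_image,
      Finset.coe_Icc, Set.mem_Icc] at hm
    obtain ⟨i, -, k, ⟨hk1, hk2⟩, j, -, rfl⟩ := hm
    have hxk : x k j ∈ 𝒜 k := by simpa using hx k j
    have h0 (i' l) (hl : l ≠ k) :
        (DirectSum.decompose 𝒜 (unop (b.repr (op (x k j) • b i) i')) l : L) = 0 := by
      rw [map_smul, b.repr_self, Finsupp.smul_apply, Finsupp.single_apply]
      split_ifs
      · rw [smul_eq_mul, mul_one, unop_op, DirectSum.decompose_of_mem_ne 𝒜 hxk (Ne.symm hl)]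
      · simp
    refine (hW _).2 ⟨fun i' l hl => h0 i' l (by omega), fun i' l hl => ?_⟩
    rw [negGrading_decompose]
    exact h0 i' _ (by omega)
  · obtain ⟨h1, h2⟩ := (hW m).1 hm
    obtain ⟨T, hT, hTm⟩ := exists_finset_gradedComponent 𝒜 b m
    rw [← hTm]
    refine Submodule.sum_mem _ fun k _ => Submodule.sum_mem _ fun i _ => ?_
    by_cases hk : k < p ∨ -p < k
    · have : (DirectSum.decompose 𝒜 (unop (b.repr m i)) k : L) = 0 := by
        rcases hk with hk | hk
        · exact h1 i k hk
        · have := h2 i (-k) (by omega)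
          rwa [negGrading_decompose, neg_neg] at this
      rw [this, op_zero, zero_smul]
      exact Submodule.zero_mem _
    · generalize hl : DirectSum.decompose 𝒜 (unop (b.repr m i)) k = l
      have : op (l : L) • b i = ∑ j, op (y k j * (l : L)) • op (x k j) • b i := by
        simp only [← mul_smul, ← op_mul, ← mul_assoc]
        rw [← Finset.sum_smul, ← Finset.op_sum, ← Finset.sum_mul, hxy, one_mul]
      rw [this]
      refine Submodule.sum_mem _ fun j _ => ?_
      have hyK : y k j * (l : L) ∈ K := by
        rw [hK]
        simpa using SetLike.GradedMul.mul_mem (hy k j) l.2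
      rw [← hM ⟨_, hyK⟩]
      refine Submodule.smul_mem _ _ (Submodule.subset_span ?_)
      simp only [S, Finset.coe_biUnion, Set.mem_iUnion, Finset.coe_image, Set.mem_image,
        Finset.coe_Icc, Set.mem_Icc]
      exact ⟨i, by simp, k, ⟨by omega, by omega⟩, j, by simp, rfl⟩

end Filtration

/-! ### Truncation of Novikov series -/

namespace Novikov

open MulOpposite BalancedTensor

variable {L : Type u} [Ring L] (𝒜 : ℤ → AddSubgroup L) [GradedRing 𝒜]

theorem ext_decompose {x y : L}
    (h : ∀ k, (DirectSum.decompose 𝒜 x k : L) = DirectSum.decompose 𝒜 y k) : x = y :=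
  (DirectSum.decompose 𝒜).injective (DFinsupp.ext fun k => Subtype.ext (h k))

/-- Coefficients vanish below the order, so only finitely many lie below `p`. -/
theorem exists_trunc (p : ℤ) (x : Novikov 𝒜) :
    ∃ l : L, ∀ k, (DirectSum.decompose 𝒜 l k : L) = if k < p then x.1.coeff k else 0 := by
  refine ⟨∑ j ∈ Finset.Ico x.1.order p, x.1.coeff j, fun k => ?_⟩
  have h (j) : (DirectSum.decompose 𝒜 (x.1.coeff j) k : L) =
      if j = k then x.1.coeff j else 0 := by
    split_ifs with h
    · subst h
      rw [DirectSum.decompose_of_mem_same 𝒜 (x.2 j)]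
    · rw [DirectSum.decompose_of_mem_ne 𝒜 (x.2 j) h]
  rw [DirectSum.decompose_sum, DFinsupp.finsetSum_apply, AddSubmonoidClass.coe_finsetSum]
  simp only [h, Finset.sum_ite_eq', Finset.mem_Ico]
  by_cases h1 : x.1.order ≤ k
  · simp [h1]
  · simp [h1, HahnSeries.coeff_eq_zero_of_lt_order (not_le.1 h1)]

/-- The part of degrees less than `p` of a Novikov series. -/
noncomputable def trunc (p : ℤ) (x : Novikov 𝒜) : L := (exists_trunc 𝒜 p x).choose

theorem decompose_trunc (p : ℤ) (x : Novikov 𝒜) (k : ℤ) :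
    (DirectSum.decompose 𝒜 (trunc 𝒜 p x) k : L) = if k < p then x.1.coeff k else 0 :=
  (exists_trunc 𝒜 p x).choose_spec k

theorem trunc_add (p : ℤ) (x y : Novikov 𝒜) :
    trunc 𝒜 p (x + y) = trunc 𝒜 p x + trunc 𝒜 p y := by
  refine ext_decompose 𝒜 fun k => ?_
  rw [DirectSum.decompose_add, DFinsupp.add_apply, AddSubgroup.coe_add]
  simp only [decompose_trunc]
  split_ifs <;> simp

/-- Factors of degree zero preserve degrees. This is why truncated contractions stay linear over
`R_0`. -/
theorem trunc_mul_incl (p : ℤ) (x : Novikov 𝒜) {r : L} (hr : r ∈ 𝒜 0) :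
    trunc 𝒜 p (x * incl 𝒜 r) = trunc 𝒜 p x * r := by
  refine ext_decompose 𝒜 fun k => ?_
  have h1 := decompose_mul_of_right_mem 𝒜 (x := trunc 𝒜 p x) hr k
  have h2 : (x.1 * HahnSeries.single 0 r).coeff (k + 0) = x.1.coeff k * r :=
    HahnSeries.coeff_mul_single_add
  rw [add_zero] at h1 h2
  rw [h1, decompose_trunc, decompose_trunc, Subring.coe_mul, incl_of_mem 𝒜 hr, h2]
  split_ifs <;> simp

variable {M : Type u} [AddCommGroup M] [Module Lᵐᵒᵖ M] {ι : Type*} [Finite ι]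
  (b : Module.Basis ι Lᵐᵒᵖ M)

/-- The elements of the completion of a free module whose coordinates have no components of degree
less than `p`. -/
noncomputable def filtration (p : ℤ) : AddSubgroup (BalancedTensor (incl 𝒜).op M) where
  carrier := {z | ∀ i k, k < p → (unop (coord (incl 𝒜).op b z i)).1.coeff k = 0}
  zero_mem' := by simp
  add_mem' {m m'} h h' i k hk := by simp [h i k hk, h' i k hk]
  neg_mem' {m} h i k hk := by simp [h i k hk]

theorem unit_mem_filtration {p : ℤ} {m : M} :
    unit (incl 𝒜).op m ∈ filtration 𝒜 b p ↔ m ∈ gradedFiltration 𝒜 b p := by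
  have h (i k) : (unop (coord (incl 𝒜).op b (unit (incl 𝒜).op m) i)).1.coeff k =
      DirectSum.decompose 𝒜 (unop (b.repr m i)) k := by
    rw [unit_apply, coord_tmul, one_mul]
    rfl
  exact forall₂_congr fun i k => by rw [h]

theorem coeff_mul_eq_zero {x y : HahnSeries ℤ L} {p q : ℤ} (hx : ∀ k < p, x.coeff k = 0)
    (hy : ∀ k < q, y.coeff k = 0) (k : ℤ) (hk : k < p + q) : (x * y).coeff k = 0 := by
  rw [HahnSeries.coeff_mul]
  refine Finset.sum_eq_zero fun ij hij => ?_
  have := (Finset.mem_antidiagonal.mp hij).2.2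
  by_cases h : ij.1 < p
  · rw [hx _ h, zero_mul]
  · rw [hy _ (by omega), mul_zero]

/-- A linear map between free modules lowers the degree by a bounded amount. -/
theorem exists_map_mem_filtration {M' : Type u} [AddCommGroup M'] [Module Lᵐᵒᵖ M']
    {ι' : Type*} [Finite ι'] (b' : Module.Basis ι' Lᵐᵒᵖ M') (φ : M →ₗ[Lᵐᵒᵖ] M') :
    ∃ δ : ℕ, ∀ p q : ℤ, q + δ ≤ p → ∀ z ∈ filtration 𝒜 b p,
      BalancedTensor.map (incl 𝒜).op φ z ∈ filtration 𝒜 b' q := by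
  have := Fintype.ofFinite ι
  let c (i : ι) (i' : ι') : Novikov 𝒜 := incl 𝒜 (unop (b'.repr (φ (b i)) i'))
  obtain ⟨N, hN⟩ := (Set.finite_range fun j : ι × ι' => (c j.1 j.2).1.order).bddBelow
  have hmap (z i') : unop (coord (incl 𝒜).op b' (BalancedTensor.map (incl 𝒜).op φ z) i') =
      ∑ i, c i i' * unop (coord (incl 𝒜).op b z i) := by
    induction z using BalancedTensor.induction_on with
    | h0 => simp
    | ha x y hx hy => simp [hx, hy, mul_add, Finset.sum_add_distrib]
    | ht x m =>
      rw [map_tmul, coord_tmul]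
      conv_lhs => rw [← b.sum_repr m]
      simp only [map_sum, map_smul, coord_tmul, unop_mul, Finsupp.finsetSum_apply,
        Finsupp.smul_apply, smul_eq_mul, map_mul, Finset.unop_sum, Finset.sum_mul, mul_assoc]
      rfl
  -- `N` bounds the degrees of all matrix entries of `φ` from below.
  refine ⟨(-N).toNat, fun p q hpq z hz i' k hk => ?_⟩
  rw [hmap, AddSubmonoidClass.coe_finsetSum, HahnSeries.coeff_sum]
  refine Finset.sum_eq_zero fun i _ => ?_
  refine coeff_mul_eq_zero (p := N) (q := p) (fun l hl => ?_) (fun l hl => hz i l hl) k (by omega)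
  exact HahnSeries.coeff_eq_zero_of_lt_order (hl.trans_le (hN ⟨(i, i'), rfl⟩))

/-- The part of degrees less than `p` of an element of the completion of a free module. -/
noncomputable def truncTensor [Fintype ι] (p : ℤ) : BalancedTensor (incl 𝒜).op M →+ M :=
  AddMonoidHom.mk' (fun z => ∑ i, op (trunc 𝒜 p (unop (coord (incl 𝒜).op b z i))) • b i)
    fun z w => by simp [trunc_add, add_smul, Finset.sum_add_distrib]

theorem repr_truncTensor [Fintype ι] (p : ℤ) (z : BalancedTensor (incl 𝒜).op M) (i : ι) :
    b.repr (truncTensor 𝒜 b p z) i = op (trunc 𝒜 p (unop (coord (incl 𝒜).op b z i))) := by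
  change b.repr (∑ i, _ • b i) i = _
  exact b.repr_sum_self (fun i => op (trunc 𝒜 p (unop (coord (incl 𝒜).op b z i)))) ▸ rfl

theorem truncTensor_smul [Fintype ι] (p : ℤ) (z : BalancedTensor (incl 𝒜).op M) {r : L}
    (hr : r ∈ 𝒜 0) : truncTensor 𝒜 b p ((incl 𝒜).op (op r) • z) =
      op r • truncTensor 𝒜 b p z := by
  refine b.ext_elem fun i => ?_
  rw [repr_truncTensor, LinearEquiv.map_smul, LinearEquiv.map_smul, Finsupp.smul_apply,
    repr_truncTensor, Pi.smul_apply, smul_eq_mul, smul_eq_mul, unop_mul, ← op_mul, ← trunc_mul_incl 𝒜 p _ hr]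
  rfl

/-- Degrees below `p` are at most `-p`, since `p ≤ 0`. -/
theorem truncTensor_mem [Fintype ι] {p : ℤ} (hp : p ≤ 0) (z : BalancedTensor (incl 𝒜).op M) :
    truncTensor 𝒜 b p z ∈ gradedFiltration (negGrading 𝒜) b p := by
  intro i k hk
  rw [negGrading_decompose, repr_truncTensor, unop_op, decompose_trunc, if_neg (by omega)]

theorem unit_truncTensor_sub_mem [Fintype ι] (p : ℤ) (z : BalancedTensor (incl 𝒜).op M) :
    unit (incl 𝒜).op (truncTensor 𝒜 b p z) - z ∈ filtration 𝒜 b p := by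
  intro i k hk
  have : (unop (coord (incl 𝒜).op b (unit (incl 𝒜).op (truncTensor 𝒜 b p z)) i)).1.coeff k =
      DirectSum.decompose 𝒜 (unop (b.repr (truncTensor 𝒜 b p z) i)) k := by
    rw [unit_apply, coord_tmul, one_mul]
    rfl
  rw [map_sub, Pi.sub_apply, MulOpposite.unop_sub, AddSubgroupClass.coe_sub, HahnSeries.coeff_sub, this,
    repr_truncTensor, unop_op, decompose_trunc, if_pos hk, sub_self]

end Novikov

/-! ### Truncated contractions -/

section Domination

open MulOpposite BalancedTensor

variable {L : Type u} [Ring L] {𝒜 : ℤ → AddSubgroup L} [GradedRing 𝒜]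

/-- `G` is the part of degrees below `p` of a contraction `s` of the completion. The remainder `s -
G` has degrees at least `p`, a range that `d` respects by `hd`; hence `1 - d G - G d = d (s - G) +
(s - G) d` lies in that range. -/
theorem exists_truncated_contraction {C : ChainComplex (ModuleCat.{u} Lᵐᵒᵖ) ℤ}
    (hC : IsBoundedComplex C) {ι : ℤ → Type*} [∀ n, Fintype (ι n)]
    (b : ∀ n, Module.Basis (ι n) Lᵐᵒᵖ (C.X n)) (p : ℤ → ℤ) (hp : ∀ n, p n ≤ 0)
    (hd : ∀ n, ∀ z ∈ Novikov.filtration 𝒜 (b (n + 1)) (p (n + 1)),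
      BalancedTensor.map (Novikov.incl 𝒜).op (C.d (n + 1) n).hom z ∈
        Novikov.filtration 𝒜 (b n) (p n))
    (h : HasTrivialHomology (tensorComplex (Novikov.incl 𝒜) C)) :
    ∃ G : ∀ n, C.X n →+ C.X (n + 1),
      (∀ n r x, r ∈ 𝒜 0 → G n (op r • x) = op r • G n x) ∧
      (∀ n x, G n x ∈ gradedFiltration (negGrading 𝒜) (b (n + 1)) (p (n + 1))) ∧
      ∀ n (x : C.X (n + 1)), x - (C.d (n + 1 + 1) (n + 1)).hom (G (n + 1) x) -
        G n ((C.d (n + 1) n).hom x) ∈ gradedFiltration 𝒜 (b (n + 1)) (p (n + 1)) := by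
  let φ := (Novikov.incl 𝒜).op
  have hb : IsBoundedComplex (tensorComplex (Novikov.incl 𝒜) C) := by
    obtain ⟨a, c, hac⟩ := hC
    refine ⟨a, c, fun n hn => ?_⟩
    have := ModuleCat.subsingleton_of_isZero (hac n hn)
    have : Subsingleton (BalancedTensor φ (C.X n)) := by
      refine subsingleton_of_forall_eq 0 fun z => ?_
      induction z using BalancedTensor.induction_on with
      | h0 => rfl
      | ha x y hx hy => rw [hx, hy, add_zero]
      | ht x m =>
        rw [Subsingleton.elim m 0, tmul_eq_smul]
        exact (congrArg _ (map_zero (unit φ))).trans (smul_zero x)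
    exact @ModuleCat.isZero_of_subsingleton _ _ _ this
  have hproj (n) : Module.Projective (Novikov 𝒜)ᵐᵒᵖ ((tensorComplex (Novikov.incl 𝒜) C).X n) :=
    Module.Projective.of_equiv (coord φ (b n)).symm
  obtain ⟨s, hs⟩ := ModuleComplex.exists_contraction hb hproj h
  let s' (n) : BalancedTensor φ (C.X n) →ₗ[(Novikov 𝒜)ᵐᵒᵖ] BalancedTensor φ (C.X (n + 1)) := s n
  let G (n) : C.X n →+ C.X (n + 1) := (Novikov.truncTensor 𝒜 (b (n + 1)) (p (n + 1))).comp
    ((s' n).toAddMonoidHom.comp (unit φ))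
  have hG (n x) : G n x = Novikov.truncTensor 𝒜 (b (n + 1)) (p (n + 1)) (s' n (unit φ x)) := rfl
  refine ⟨G, fun n r x hr => ?_, fun n x => Novikov.truncTensor_mem 𝒜 _ (hp _) _, fun n x => ?_⟩
  · have : unit φ (op r • x) = φ (op r) • unit φ x := by
      rw [unit_apply, unit_apply, tmul_smul, smul_tmul, one_mul, mul_one]
    rw [hG, this, map_smul, Novikov.truncTensor_smul 𝒜 _ _ _ hr, hG]
  · rw [← Novikov.unit_mem_filtration, map_sub, map_sub]
    have h1 := hd _ _ (Novikov.unit_truncTensor_sub_mem 𝒜 (b (n + 1 + 1)) (p (n + 1 + 1))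
      (s' (n + 1) (unit φ x)))
    have h2 := Novikov.unit_truncTensor_sub_mem 𝒜 (b (n + 1)) (p (n + 1))
      (s' n (unit φ ((C.d (n + 1) n).hom x)))
    have h3 : unit φ x = s' n (BalancedTensor.map φ (C.d (n + 1) n).hom (unit φ x)) +
      BalancedTensor.map φ (C.d (n + 1 + 1) (n + 1)).hom (s' (n + 1) (unit φ x)) :=
        hs n (unit φ x)
    have h4 := neg_mem (add_mem h1 h2)
    rw [map_sub] at h4
    have aux {u v w x y : BalancedTensor φ (C.X (n + 1))} (h : u = v + w) :
        -(x - w + (y - v)) = u - x - y := by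
      rw [h]
      abel
    exact cast (congrArg (· ∈ Novikov.filtration 𝒜 (b (n + 1)) (p (n + 1))) (aux h3)) h4

end Domination

/-! ### Deforming the identity into a subcomplex -/

namespace ModuleComplex

variable {A : Type u} [Ring A]

theorem exists_homotopic_id {X : ChainComplex (ModuleCat.{u} A) ℤ}
    (s : ∀ n : ℤ, X.X n →ₗ[A] X.X (n + 1)) :
    ∃ E : X ⟶ X, Nonempty (Homotopy E (𝟙 X)) ∧ ∀ (n : ℤ) (x : X.X (n + 1)),
      (E.f (n + 1)).hom x = x - (X.d (n + 1 + 1) (n + 1)).hom (s (n + 1) x) -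
        s n ((X.d (n + 1) n).hom x) := by
  let hom (i j : ℤ) : X.X i ⟶ X.X j :=
    if h : i + 1 = j then ModuleCat.ofHom (s i) ≫ eqToHom (by rw [h]) else 0
  have hf (n : ℤ) (x : X.X (n + 1)) : ((𝟙 X - Homotopy.nullHomotopicMap hom).f (n + 1)).hom x =
      x - (X.d (n + 1 + 1) (n + 1)).hom (s (n + 1) x) - s n ((X.d (n + 1) n).hom x) := by
    rw [HomologicalComplex.sub_f_apply, Homotopy.nullHomotopicMap_f
      (show (ComplexShape.down ℤ).Rel (n + 1 + 1) (n + 1) from rfl)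
      (show (ComplexShape.down ℤ).Rel (n + 1) n from rfl)]
    simp [hom]
    abel
  refine ⟨_, ⟨homotopyOfMaps (fun n => -s n) fun n x => ?_⟩, hf⟩
  rw [hf]
  simp
  abel

/-- If an endomorphism homotopic to the identity takes values in a subcomplex, then the complex is
a homotopy retract of the subcomplex. -/
theorem exists_isHomotopyRetract_of_submodule {X : ChainComplex (ModuleCat.{u} A) ℤ} (E : X ⟶ X)
    (hE : Nonempty (Homotopy E (𝟙 X))) (W : ∀ n, Submodule A (X.X n))
    (hEW : ∀ n x, (E.f n).hom x ∈ W n) (hdW : ∀ i j, ∀ x ∈ W i, (X.d i j).hom x ∈ W j) :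
    ∃ D, IsHomotopyRetract X D ∧ ∀ n, D.X n = ModuleCat.of A (W n) := by
  let D : ChainComplex (ModuleCat.{u} A) ℤ :=
    { X := fun n => ModuleCat.of A (W n)
      d := fun i j => ModuleCat.ofHom ((X.d i j).hom.restrict (hdW i j))
      shape := fun i j h => ModuleCat.hom_ext (LinearMap.ext fun x => Subtype.ext (by
        change (X.d i j).hom x.1 = 0
        rw [X.shape i j h]
        rfl))
      d_comp_d' := fun i j k _ _ => ModuleCat.hom_ext (LinearMap.ext fun x => Subtype.ext
        (d_d i j k x.1)) }
  let i : X ⟶ D :=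
    { f := fun n => ModuleCat.ofHom ((E.f n).hom.codRestrict (W n) (hEW n))
      comm' := fun i j _ => ModuleCat.hom_ext (LinearMap.ext fun x => Subtype.ext
        (map_d E i j x).symm) }
  let r : D ⟶ X :=
    { f := fun n => ModuleCat.ofHom (W n).subtype
      comm' := fun i j _ => rfl }
  refine ⟨D, ⟨i, r, ?_⟩, fun n => rfl⟩
  have : i ≫ r = E := by
    ext n x
    rfl
  rwa [this]

end ModuleComplex

/-! ### Acyclic completions imply domination by finitely generated modules -/

section Domination

open MulOpposite BalancedTensor

variable {L : Type u} [Ring L] {𝒜 : ℤ → AddSubgroup L} [GradedRing 𝒜]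

/-- Degree bounds that are compatible with the differential of a bounded complex. -/
theorem exists_degree_bounds {C : ChainComplex (ModuleCat.{u} Lᵐᵒᵖ) ℤ}
    (hC : IsBoundedComplex C) {ι : ℤ → Type*} [∀ n, Fintype (ι n)]
    (b : ∀ n, Module.Basis (ι n) Lᵐᵒᵖ (C.X n)) :
    ∃ p : ℤ → ℤ, (∀ n, p n ≤ 0) ∧
      (∀ n, ∀ z ∈ Novikov.filtration 𝒜 (b (n + 1)) (p (n + 1)),
        BalancedTensor.map (Novikov.incl 𝒜).op (C.d (n + 1) n).hom z ∈
          Novikov.filtration 𝒜 (b n) (p n)) ∧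
      (∀ n, ∀ z ∈ Novikov.filtration (negGrading 𝒜) (b (n + 1)) (p (n + 1)),
        BalancedTensor.map (Novikov.incl (negGrading 𝒜)).op (C.d (n + 1) n).hom z ∈
          Novikov.filtration (negGrading 𝒜) (b n) (p n)) := by
  obtain ⟨a, c, hac⟩ := hC
  choose δ hδ using fun n =>
    Novikov.exists_map_mem_filtration 𝒜 (b (n + 1)) (b n) (C.d (n + 1) n).hom
  choose ε hε using fun n =>
    Novikov.exists_map_mem_filtration (negGrading 𝒜) (b (n + 1)) (b n) (C.d (n + 1) n).hom
  -- The differential out of degree `j + 1` lowers degrees by at most `δ j`, and by at most `ε j` in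
  -- the reversed grading. Summing up to the top degree `c` accommodates both at once.
  let p (n : ℤ) : ℤ := -∑ j ∈ Finset.Ico n c, ((δ j : ℤ) + ε j)
  have hp (n) (hn : n < c) : p n = p (n + 1) - (δ n + ε n) := by
    have : Finset.Ico n c = insert n (Finset.Ico (n + 1) c) := by
      ext k
      simp only [Finset.mem_Ico, Finset.mem_insert]
      omega
    simp only [p]
    rw [this, Finset.sum_insert (by simp)]
    ring
  have hzero (n) (hn : ¬ n < c) : (C.d (n + 1) n).hom = 0 := by
    have := ModuleCat.subsingleton_of_isZero (hac (n + 1) (Or.inr (by omega)))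
    exact LinearMap.ext fun x => by rw [Subsingleton.elim x 0, map_zero, map_zero]
  have hmap0 {B : Type u} [Ring B] (φ : Lᵐᵒᵖ →+* B) (n) (z : BalancedTensor φ (C.X (n + 1))) :
      BalancedTensor.map φ (0 : C.X (n + 1) →ₗ[Lᵐᵒᵖ] C.X n) z = 0 := by
    induction z using BalancedTensor.induction_on with
    | h0 => rw [map_zero]
    | ha x y hx hy => rw [map_add, hx, hy, add_zero]
    | ht x m =>
      rw [map_tmul, tmul_eq_smul]
      exact (congrArg _ (map_zero (unit φ))).trans (smul_zero x)
  refine ⟨p, fun n => neg_nonpos.2 (Finset.sum_nonneg fun j _ => by positivity),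
    fun n z hz => ?_, fun n z hz => ?_⟩
  · by_cases hn : n < c
    · exact hδ n _ _ (by rw [hp n hn]; omega) z hz
    · rw [hzero n hn, hmap0]
      exact zero_mem _
  · by_cases hn : n < c
    · exact hε n _ _ (by rw [hp n hn]; omega) z hz
    · rw [hzero n hn, hmap0]
      exact zero_mem _

/-- If both Novikov completions of `C` are acyclic, then `C` is a homotopy retract of a complex of
finitely generated modules over the subring of degree zero. -/
theorem exists_isHomotopyRetract (h𝒜 : IsStronglyGraded 𝒜) {K : Subring L}
    (hK : ∀ x, x ∈ K ↔ x ∈ 𝒜 0) {C : ChainComplex (ModuleCat.{u} Lᵐᵒᵖ) ℤ} (hC : IsBoundedFGFree C)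
    (h1 : HasTrivialHomology (tensorComplex (NovikovInv.incl 𝒜) C))
    (h2 : HasTrivialHomology (tensorComplex (Novikov.incl 𝒜) C)) :
    ∃ D, ModuleComplex.IsHomotopyRetract (restrictComplex K C) D ∧
      ∀ j, Module.Finite Kᵐᵒᵖ (D.X j) := by
  have hfree (n) := (hC.2 n).2
  have hfin (n) := (hC.2 n).1
  let b (n) := Module.Free.chooseBasis Lᵐᵒᵖ (C.X n)
  obtain ⟨p, hp, hd, hd'⟩ := exists_degree_bounds (𝒜 := 𝒜) hC.1 b
  obtain ⟨G, hGs, hGm, hG⟩ := exists_truncated_contraction hC.1 b p hp hd h2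
  obtain ⟨G', hGs', hGm', hG'⟩ := exists_truncated_contraction hC.1 b p hp hd' h1
  simp only [gradedFiltration_negGrading_negGrading] at hGm'
  have hdF (n) (x) (hx : x ∈ gradedFiltration 𝒜 (b (n + 1)) (p (n + 1))) :
      (C.d (n + 1) n).hom x ∈ gradedFiltration 𝒜 (b n) (p n) :=
    (Novikov.unit_mem_filtration 𝒜 (b n)).1
      (hd n _ ((Novikov.unit_mem_filtration 𝒜 (b (n + 1))).2 hx))
  have hdF' (n) (x) (hx : x ∈ gradedFiltration (negGrading 𝒜) (b (n + 1)) (p (n + 1))) :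
      (C.d (n + 1) n).hom x ∈ gradedFiltration (negGrading 𝒜) (b n) (p n) :=
    (Novikov.unit_mem_filtration (negGrading 𝒜) (b n)).1
      (hd' n _ ((Novikov.unit_mem_filtration (negGrading 𝒜) (b (n + 1))).2 hx))
  let X := restrictComplex K C
  let s (n : ℤ) : X.X n →ₗ[Kᵐᵒᵖ] X.X (n + 1) :=
    { toFun := fun x => G n x + G' n x
      map_add' := fun x y => by
        refine Eq.trans (congrArg₂ _ (map_add (G n) x y) (map_add (G' n) x y)) ?_
        exact add_add_add_comm _ _ _ _
      map_smul' := fun c x => by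
        have hc := (hK _).1 (unop c).2
        let x' : C.X n := x
        have h : op ((unop c : K) : L) • G n x' + op ((unop c : K) : L) • G' n x' =
          op ((unop c : K) : L) • (G n x' + G' n x') := (smul_add _ _ _).symm
        refine Eq.trans (congrArg₂ _ (hGs n _ x hc) (hGs' n _ x ?_)) h
        change _ ∈ 𝒜 (-0)
        rwa [neg_zero] }
  obtain ⟨E, hE, hEs⟩ := ModuleComplex.exists_homotopic_id s
  let W (n : ℤ) : Submodule Kᵐᵒᵖ (X.X n) :=
    { carrier := {x | (x : C.X n) ∈ gradedFiltration 𝒜 (b n) (p n) ∧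
        (x : C.X n) ∈ gradedFiltration (negGrading 𝒜) (b n) (p n)}
      zero_mem' := ⟨zero_mem _, zero_mem _⟩
      add_mem' := fun hx hy => ⟨add_mem hx.1 hy.1, add_mem hx.2 hy.2⟩
      smul_mem' := fun c x hx => by
        have hc := (hK _).1 (unop c).2
        refine ⟨smul_mem_gradedFiltration 𝒜 (b n) hx.1 hc,
          smul_mem_gradedFiltration (negGrading 𝒜) (b n) hx.2 ?_⟩
        change _ ∈ 𝒜 (-0)
        rwa [neg_zero] }
  -- `1 - d G - G d` has degrees at least `p`. So have `d G'` and `G' d`, because `G'` takes values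
  -- in degrees above `-p ≥ p`. With the roles exchanged, degrees are also at most `-p`.
  have hEW (n) (x : X.X n) : (E.f n).hom x ∈ W n := by
    obtain ⟨m, rfl⟩ : ∃ m, n = m + 1 := ⟨n - 1, by ring⟩
    rw [hEs]
    let x' : C.X (m + 1) := x
    have aux {x a a' c c' e : C.X (m + 1)} (h : e = a + a') :
        x - a - c - (a' + c') = x - e - (c + c') := by
      rw [h]
      abel
    have aux' {x a a' c c' e : C.X (m + 1)} (h : e = a + a') :
        x - a' - c' - (a + c) = x - e - (c + c') := by
      rw [h]
      abel
    have key : x' - (C.d (m + 1 + 1) (m + 1)).hom (G (m + 1) x' + G' (m + 1) x') -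
        (G m ((C.d (m + 1) m).hom x') + G' m ((C.d (m + 1) m).hom x')) ∈ W (m + 1) := by
      constructor
      · have := sub_mem (hG m x') (add_mem (hdF _ _ (hGm' (m + 1) x')) (hGm' m ((C.d (m + 1) m).hom x')))
        exact cast (congrArg (· ∈ gradedFiltration 𝒜 (b (m + 1)) (p (m + 1)))
          (aux (map_add _ _ _))) this
      · have := sub_mem (hG' m x') (add_mem (hdF' _ _ (hGm (m + 1) x')) (hGm m ((C.d (m + 1) m).hom x')))
        exact cast (congrArg (· ∈ gradedFiltration (negGrading 𝒜) (b (m + 1)) (p (m + 1)))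
          (aux' (map_add _ _ _))) this
    exact key
  have hdW (i j) (x : X.X i) (hx : x ∈ W i) : (X.d i j).hom x ∈ W j := by
    by_cases hij : j + 1 = i
    · subst hij
      exact ⟨hdF j x hx.1, hdF' j x hx.2⟩
    · rw [X.shape i j hij]
      exact zero_mem _
  obtain ⟨D, hD, hDW⟩ := ModuleComplex.exists_isHomotopyRetract_of_submodule E hE W hEW hdW
  refine ⟨D, hD, fun n => ?_⟩
  rw [hDW]
  let _ : Module Kᵐᵒᵖ (C.X n) := Module.compHom (C.X n) K.subtype.op
  exact Module.Finite.iff_fg.2 (h𝒜.fg_of_mem_gradedFiltration (M := C.X n) (b n) hK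
    (hM := fun c m => rfl) (p n) (W n) fun m => Iff.rfl)

end Domination

/-! ### The equivalences -/

theorem theorem1p2 {L : Type u} [Ring L] (𝒜 : ℤ → AddSubgroup L) [GradedRing 𝒜]
    (h𝒜 : IsStronglyGraded 𝒜)
    (C : ChainComplex (ModuleCat.{u} Lᵐᵒᵖ) ℤ) (hC : IsBoundedFGFree C) :
    (IsFinitelyDominated (SetLike.GradeZero.subring 𝒜) C ↔
      HasTrivialHomology (tensorComplex (NovikovInv.incl 𝒜) C) ∧
        HasTrivialHomology (tensorComplex (Novikov.incl 𝒜) C)) ∧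
    (IsHomotopyEquivFGProjective (SetLike.GradeZero.subring 𝒜) C ↔
      HasTrivialHomology (tensorComplex (NovikovInv.incl 𝒜) C) ∧
        HasTrivialHomology (tensorComplex (Novikov.incl 𝒜) C)) := by
  set K := SetLike.GradeZero.subring 𝒜
  have hK (x : L) : x ∈ K ↔ x ∈ 𝒜 0 := Iff.rfl
  have hK' (x : L) : x ∈ K ↔ x ∈ negGrading 𝒜 0 := by
    change _ ↔ x ∈ 𝒜 (-0)
    rw [neg_zero, hK]
  have h1 : IsHomotopyEquivFGProjective K C → IsFinitelyDominated K C := by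
    rintro ⟨E, hE, ⟨e⟩⟩
    obtain ⟨D, hD, i, r, hir⟩ := ModuleComplex.exists_free_retract hE
    refine ⟨D, hD, e.hom ≫ i, r ≫ e.inv, ⟨(Homotopy.ofEq ?_).trans e.homotopyHomInvId⟩⟩
    rw [Category.assoc, reassoc_of% hir]
  have h2 (h : IsFinitelyDominated K C) :
      HasTrivialHomology (tensorComplex (NovikovInv.incl 𝒜) C) ∧
        HasTrivialHomology (tensorComplex (Novikov.incl 𝒜) C) :=
    -- Reversing the grading keeps the degree zero subring and exchanges the two Novikov rings.
    ⟨h.hasTrivialHomology h𝒜.neg hK' hC, h.hasTrivialHomology h𝒜 hK hC⟩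
  have h3 (h : HasTrivialHomology (tensorComplex (NovikovInv.incl 𝒜) C) ∧
        HasTrivialHomology (tensorComplex (Novikov.incl 𝒜) C)) :
      IsHomotopyEquivFGProjective K C := by
    obtain ⟨D, hD, hfin⟩ := exists_isHomotopyRetract h𝒜 hK hC h.1 h.2
    -- `D` is only known to be finitely generated; projectivity comes from `C` itself over `K`.
    refine hD.exists_homotopyEquiv hfin ?_ fun n => ?_
    · obtain ⟨a, c, hac⟩ := hC.1
      refine ⟨a, c, fun n hn => ?_⟩
      have := ModuleCat.subsingleton_of_isZero (hac n hn)
      exact @ModuleCat.isZero_of_subsingleton _ _ ((restrictComplex K C).X n) this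
    · obtain ⟨_, _⟩ := hC.2 n
      let _ : Module Kᵐᵒᵖ (C.X n) := Module.compHom (C.X n) K.subtype.op
      exact h𝒜.projective (M := C.X n) hK (Module.Free.chooseBasis Lᵐᵒᵖ (C.X n))
        fun c m => rfl
  exact ⟨⟨h2, fun h => h1 (h3 h)⟩, ⟨fun h => h2 (h1 h), h3⟩⟩
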